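/- For $d>0$ and $n\ge d$ let $G^{\mathrm{bip}}_{n,d}$ be the random bipartite graph with vertex classes $L,R$, each of size $n$, in which every pair in $L\times R$ is an edge independently with probability $d/n$. For $\gamma\in(0,1/2]$, a $\gamma$-balanced independent set of a bipartite graph with classes $(L,R)$ is an independent set $I$ with $\bigl||I\cap L|-\gamma|I|\bigr|<1$, and $X_\gamma$ denotes the size of the largest $\gamma$-balanced independent set of $G^{\mathrm{bip}}_{n,d}$. For every $\gamma\in(0,1/2]$ and every $\varepsilon>0$ there is $d_0$ such that for every real $d\ge d_0$, with probability tending to $1$ as $n\to\infty$, $$\left(\frac{1}{2\gamma(1-\gamma)}-\varepsilon\right)\frac{\log d}{d}\;\le\;\frac{X_\gamma}{2n}\;\le\;\left(\frac{1}{2\gamma(1-\gamma)}+\varepsilon\right)\frac{\log d}{d}.$$ In particular, there is a function $\delta$ with $\delta(d)\to0$ as $d\to\infty$ such that for every sufficiently large $d$, with probability tending to $1$ as $n\to\infty$, the density (size divided by $2n$) of the largest balanced independent set of $G^{\mathrm{bip}}_{n,d}$ lies between $(2-\delta(d))\frac{\log d}{d}$ and $(2+\delta(d))\frac{\log d}{d}$;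 this holds both for $\tfrac12$-balanced independent sets and for independent sets $I$ with exactly $|I\cap L|=|I\cap R|$. -/

import Mathlib

open MeasureTheory ProbabilityTheory Filter Topology

namespace BalancedIndep

/-- The two sides `L` and `R`: `Sum.inl i` is the `i`-th vertex of `L`, `Sum.inr j` the `j`-th
vertex of `R`. -/
abbrev Vertex (n : ℕ) : Type := Fin n ⊕ Fin n

/-- The bipartite graph on `(L, R)` whose edges in `L × R` are the pairs `(i, j)` with
`A (i, j) = true`. -/
def bipGraph {n : ℕ} (A : Fin n × Fin n → Bool) : SimpleGraph (Vertex n) where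
  Adj
    | Sum.inl i, Sum.inr j => A (i, j) = true
    | Sum.inr j, Sum.inl i => A (i, j) = true
    | _, _ => False
  symm := ⟨by rintro (i | i) (j | j) h <;> exact h⟩
  loopless := ⟨by rintro (i | i) h <;> exact h⟩

/-- The edge probability `d / n`, truncated to `[0, 1]`; the truncation only matters when
`n < d` (or `d < 0`). -/
noncomputable def edgeProb (n : ℕ) (d : ℝ) : unitInterval :=
  Set.projIcc (0 : ℝ) 1 zero_le_one (d / n)

/-- The law of the edge indicators of the bipartite Erdős–Rényi random graph: independent
Bernoulli variables of parameter `d / n`, one for each pair in `L × R`. -/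
noncomputable def bipLaw (n : ℕ) (d : ℝ) : Measure (Fin n × Fin n → Bool) :=
  Measure.pi fun _ => bernoulliMeasure true false (edgeProb n d)

/-- `I` is a `γ`-balanced independent set: it is independent and `| |I ∩ L| - γ |I| | < 1`. -/
def IsGammaBalancedIndep {n : ℕ} (γ : ℝ) (G : SimpleGraph (Vertex n))
    (I : Finset (Vertex n)) : Prop :=
  G.IsIndepSet (I : Set (Vertex n)) ∧ |(I.toLeft.card : ℝ) - γ * (I.card : ℝ)| < 1

/-- `I` is a balanced independent set: it is independent and has equally many vertices in
`L` and in `R`. -/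
def IsBalancedIndep {n : ℕ} (G : SimpleGraph (Vertex n)) (I : Finset (Vertex n)) : Prop :=
  G.IsIndepSet (I : Set (Vertex n)) ∧ I.toLeft.card = I.toRight.card

open Classical in
/-- The size of the largest `γ`-balanced independent set (the empty set is always one). -/
noncomputable def maxGammaBalanced {n : ℕ} (γ : ℝ) (G : SimpleGraph (Vertex n)) : ℕ :=
  (Finset.univ.filter (IsGammaBalancedIndep γ G)).sup Finset.card

open Classical in
/-- The size of the largest balanced independent set (the empty set is always one). -/
noncomputable def maxBalanced {n : ℕ} (G : SimpleGraph (Vertex n)) : ℕ :=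
  (Finset.univ.filter (IsBalancedIndep G)).sup Finset.card

/-- With high probability as `n → ∞` (for fixed `d`), the property `P` holds for the random
bipartite graph with `n` vertices on each side and edge probability `d / n`. -/
def Whp (d : ℝ) (P : ∀ n : ℕ, SimpleGraph (Vertex n) → Prop) : Prop :=
  Tendsto (fun n : ℕ => (bipLaw n d).real {A | P n (bipGraph A)}) atTop (𝓝 1)

end BalancedIndep

/-!
Write `ρ = log d / d`. The expected number of empty `a × b` rectangles with `a = γ K ρ n` and
`b = (1 - γ) K ρ n` is `exp ((1 - γ (1 - γ) K + o(1)) K n log² d / d)`, with `o(1)` as `d → ∞`, so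
the threshold is `γ (1 - γ) K = 1` and the union bound gives the upper bound.

Below the threshold the second moment is too large to give existence with high probability, but by
the Chung–Erdős inequality an empty rectangle exists with probability at least
`exp (-O(log⁴ d / d³) n)`. The largest number of common non-neighbours of a `b`-subset of `R`
changes by at most one when the edges at one vertex of `L` are resampled, so by McDiarmid's
inequality the probability that it is `τ n` below `a` is at most `exp (-τ² n / 2)` divided by that
lower bound. For `τ` a small multiple of `ρ` this tends to `0`, since
`log⁴ d / d³ = o(log² d / d²)`.
-/

namespace BalancedIndep

section BoundedDifferences

open scoped NNReal

lemma integrable_of_hasSubgaussianMGF_sub_const {Ω : Type*} [MeasurableSpace Ω] {μ : Measure Ω}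
    [IsFiniteMeasure μ] {f : Ω → ℝ} {m : ℝ} {c : ℝ≥0}
    (h : HasSubgaussianMGF (fun x => f x - m) c μ) : Integrable f μ :=
  (h.integrable.add (integrable_const m)).congr (ae_of_all _ fun _ => sub_add_cancel _ _)

lemma dist_integral_le_of_dist_le {Ω : Type*} [MeasurableSpace Ω] {μ : Measure Ω}
    [IsProbabilityMeasure μ] {f g : Ω → ℝ} (hf : Integrable f μ) (hg : Integrable g μ) {c : ℝ}
    (h : ∀ x, dist (f x) (g x) ≤ c) : dist (∫ x, f x ∂μ) (∫ x, g x ∂μ) ≤ c := by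
  rw [dist_eq_norm, ← integral_sub hf hg]
  refine (norm_integral_le_of_norm_le_const (ae_of_all _ fun x => ?_)).trans_eq
    (by rw [probReal_univ, mul_one])
  simpa only [dist_eq_norm] using h x

lemma hasSubgaussianMGF_sub_integral_of_dist_le {Ω : Type*} [MeasurableSpace Ω] {μ : Measure Ω}
    [IsProbabilityMeasure μ] {f : Ω → ℝ} (hf : AEMeasurable f μ) {c : ℝ≥0}
    (hc : ∀ x y, dist (f x) (f y) ≤ c) :
    HasSubgaussianMGF (fun x => f x - ∫ y, f y ∂μ) ((c / 2) ^ 2) μ := by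
  obtain ⟨x₀⟩ := nonempty_of_isProbabilityMeasure μ
  have hbdd : BddBelow (Set.range f) := by
    refine ⟨f x₀ - c, ?_⟩
    rintro _ ⟨x, rfl⟩
    linarith [(abs_le.1 (hc x x₀)).1]
  have hIcc : ∀ x, f x ∈ Set.Icc (⨅ y, f y) ((⨅ y, f y) + c) := fun x => by
    have hx : f x - c ≤ ⨅ y, f y :=
      have : Nonempty Ω := ⟨x₀⟩
      le_ciInf fun y => by linarith [(abs_le.1 (hc x y)).2]
    exact ⟨ciInf_le hbdd x, by linarith⟩
  simpa only [add_sub_cancel_left, NNReal.nnnorm_eq] using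
    hasSubgaussianMGF_of_mem_Icc hf (ae_of_all μ hIcc)

lemma hasSubgaussianMGF_sub_integral_prod {α β : Type*} [MeasurableSpace α] [MeasurableSpace β]
    {μ : Measure α} {ν : Measure β} [IsProbabilityMeasure μ] [IsProbabilityMeasure ν]
    {f : α × β → ℝ} (hf : Measurable f) {a b : ℝ≥0}
    (ha : HasSubgaussianMGF (fun x => (∫ y, f (x, y) ∂ν) - ∫ x, ∫ y, f (x, y) ∂ν ∂μ) a μ)
    (hb : ∀ x, HasSubgaussianMGF (fun y => f (x, y) - ∫ y, f (x, y) ∂ν) b ν) :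
    HasSubgaussianMGF (fun z => f z - ∫ z, f z ∂(μ.prod ν)) (a + b) (μ.prod ν) := by
  set g : α → ℝ := fun x => ∫ y, f (x, y) ∂ν
  set m : ℝ := ∫ x, g x ∂μ
  have hsplit : ∀ t x y, Real.exp (t * (f (x, y) - m)) =
      Real.exp (t * (g x - m)) * Real.exp (t * (f (x, y) - g x)) := fun t x y => by
    rw [← Real.exp_add]; ring_nf
  have hsection : ∀ t x, ∫ y, Real.exp (t * (f (x, y) - m)) ∂ν ≤
      Real.exp (t * (g x - m)) * Real.exp (b * t ^ 2 / 2) := fun t x => by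
    simp only [hsplit, integral_const_mul]
    gcongr
    exact (hb x).mgf_le t
  have hint : ∀ t, Integrable (fun z => Real.exp (t * (f z - m))) (μ.prod ν) := fun t => by
    have hmeas : Measurable fun z => Real.exp (t * (f z - m)) := by fun_prop
    refine (integrable_prod_iff hmeas.aestronglyMeasurable).2 ⟨ae_of_all _ fun x => ?_, ?_⟩
    · simpa only [hsplit] using ((hb x).integrable_exp_mul t).const_mul _
    · refine ((ha.integrable_exp_mul t).mul_const (Real.exp (b * t ^ 2 / 2))).mono'
        hmeas.norm.stronglyMeasurable.integral_prod_right'.aestronglyMeasurable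
        (ae_of_all _ fun x => ?_)
      simp only [Real.norm_eq_abs, Real.abs_exp]
      exact (abs_of_nonneg (integral_nonneg fun y => (Real.exp_pos _).le)).trans_le
        (hsection t x)
  have hmean : HasSubgaussianMGF (fun z => f z - m) (a + b) (μ.prod ν) := by
    refine ⟨hint, fun t => ?_⟩
    calc mgf (fun z => f z - m) (μ.prod ν) t
        = ∫ x, ∫ y, Real.exp (t * (f (x, y) - m)) ∂ν ∂μ := integral_prod _ (hint t)
      _ ≤ ∫ x, Real.exp (t * (g x - m)) * Real.exp (b * t ^ 2 / 2) ∂μ :=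
          integral_mono (hint t).integral_prod_left ((ha.integrable_exp_mul t).mul_const _)
            (hsection t)
      _ ≤ Real.exp (a * t ^ 2 / 2) * Real.exp (b * t ^ 2 / 2) := by
          rw [integral_mul_const]
          gcongr
          exact ha.mgf_le t
      _ = Real.exp ((a + b : ℝ≥0) * t ^ 2 / 2) := by
          rw [← Real.exp_add, NNReal.coe_add]; ring_nf
  rwa [integral_prod f (integrable_of_hasSubgaussianMGF_sub_const hmean)]

/-- McDiarmid's bounded differences inequality. -/
theorem hasSubgaussianMGF_sub_integral_pi {n : ℕ} {α : Fin n → Type*}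
    [∀ i, MeasurableSpace (α i)] (μ : ∀ i, Measure (α i)) [∀ i, IsProbabilityMeasure (μ i)]
    {f : (∀ i, α i) → ℝ} (hf : Measurable f) {c : Fin n → ℝ≥0}
    (hc : ∀ x i a, dist (f (Function.update x i a)) (f x) ≤ c i) :
    HasSubgaussianMGF (fun x => f x - ∫ y, f y ∂(Measure.pi μ)) (∑ i, (c i / 2) ^ 2)
      (Measure.pi μ) := by
  induction n with
  | zero =>
    have hconst : ∀ x, f x - ∫ y, f y ∂(Measure.pi μ) = 0 := fun x => by
      simp [integral_unique, Subsingleton.elim default x]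
    simp [hconst]
  | succ n ih =>
    have hmp : MeasurePreserving (fun x : ∀ i, α i => (x 0, fun j : Fin n => x j.succ))
        (Measure.pi μ) ((μ 0).prod (Measure.pi fun j => μ j.succ)) :=
      measurePreserving_piFinSuccAbove μ 0
    let F : α 0 × (∀ j : Fin n, α j.succ) → ℝ := fun z => f (Fin.cons z.1 z.2)
    have hF : Measurable F := hf.comp <| measurable_pi_iff.2 <|
      Fin.cases measurable_fst fun j => (measurable_pi_apply j).comp measurable_snd
    have htail : ∀ a, HasSubgaussianMGF
        (fun y => F (a, y) - ∫ y, F (a, y) ∂(Measure.pi fun j : Fin n => μ j.succ))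
        (∑ j, (c (Fin.succ j) / 2) ^ 2) (Measure.pi fun j => μ j.succ) := fun a =>
      ih (fun j => μ j.succ) (f := fun y => F (a, y)) (hF.comp measurable_prodMk_left)
        fun y j b => by simpa only [F, Fin.cons_update] using hc (Fin.cons a y) j.succ b
    have hhead := hasSubgaussianMGF_sub_integral_of_dist_le (μ := μ 0) (c := c 0)
      (f := fun a => ∫ y, F (a, y) ∂(Measure.pi fun j : Fin n => μ j.succ))
      hF.stronglyMeasurable.integral_prod_right'.measurable.aemeasurable fun a b =>
        dist_integral_le_of_dist_le (integrable_of_hasSubgaussianMGF_sub_const (htail a))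
          (integrable_of_hasSubgaussianMGF_sub_const (htail b)) fun y => by
            simpa only [F, Fin.update_cons_zero] using hc (Fin.cons b y) 0 a
    have hf_eq : ∀ x : ∀ i, α i, F (x 0, fun j : Fin n => x j.succ) = f x := fun x =>
      congrArg f (Fin.cons_self_tail x)
    have hmean : ∫ z, F z ∂((μ 0).prod (Measure.pi fun j : Fin n => μ j.succ)) =
        ∫ x, f x ∂(Measure.pi μ) := by
      rw [← hmp.map_eq, integral_map hmp.aemeasurable hF.aestronglyMeasurable]
      simp only [hf_eq]
    have hprod := hasSubgaussianMGF_sub_integral_prod hF hhead htail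
    rw [hmean, ← hmp.map_eq] at hprod
    simpa only [Function.comp_def, hf_eq, Fin.sum_univ_succ] using hprod.of_map hmp.aemeasurable

lemma measureReal_ge_mul_measureReal_le_le {Ω : Type*} [MeasurableSpace Ω] {μ : Measure Ω}
    [IsProbabilityMeasure μ] {f : Ω → ℝ} {c : ℝ≥0} {m : ℝ}
    (h : HasSubgaussianMGF (fun x => f x - m) c μ) {u v : ℝ} (huv : v ≤ u) :
    μ.real {x | u ≤ f x} * μ.real {x | f x ≤ v} ≤ Real.exp (-(u - v) ^ 2 / (8 * c)) := by
  have hmid : -(u - v) ^ 2 / (8 * c) = -((u - v) / 2) ^ 2 / (2 * c) := by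
    rw [← mul_div_mul_left (-((u - v) / 2) ^ 2) (2 * (c : ℝ)) four_ne_zero]; ring_nf
  have hε : 0 ≤ (u - v) / 2 := by linarith
  rw [hmid]
  rcases le_total m ((u + v) / 2) with hm | hm
  · calc μ.real {x | u ≤ f x} * μ.real {x | f x ≤ v}
        ≤ μ.real {x | u ≤ f x} := mul_le_of_le_one_right measureReal_nonneg measureReal_le_one
      _ ≤ μ.real {x | (u - v) / 2 ≤ f x - m} :=
          measureReal_mono fun x (hx : u ≤ f x) => by
            rw [Set.mem_ofPred_eq]; linarith
      _ ≤ _ := h.measure_ge_le hε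
  · calc μ.real {x | u ≤ f x} * μ.real {x | f x ≤ v}
        ≤ μ.real {x | f x ≤ v} := mul_le_of_le_one_left measureReal_nonneg measureReal_le_one
      _ ≤ μ.real {x | (u - v) / 2 ≤ -(f x - m)} :=
          measureReal_mono fun x (hx : f x ≤ v) => by
            rw [Set.mem_ofPred_eq]; linarith
      _ ≤ _ := h.neg.measure_ge_le hε

end BoundedDifferences

section SecondMoment

lemma sq_integral_le_measureReal_mul_integral_sq {Ω : Type*} [MeasurableSpace Ω] {μ : Measure Ω}
    [IsFiniteMeasure μ] {f : Ω → ℝ} (hf : MemLp f 2 μ) {U : Set Ω} (hU : MeasurableSet U)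
    (hfU : ∀ x ∉ U, f x = 0) : (∫ x, f x ∂μ) ^ 2 ≤ μ.real U * ∫ x, f x ^ 2 ∂μ := by
  have hU_int : Integrable (U.indicator (1 : Ω → ℝ)) μ := (integrable_const 1).indicator hU
  have hf_int : Integrable f μ := hf.integrable one_le_two
  have hexpand : ∀ t x, (t * U.indicator 1 x - f x) ^ 2 =
      t * t * U.indicator 1 x + -2 * t * f x + f x ^ 2 := fun t x => by
    by_cases hx : x ∈ U
    · simp only [hx, Set.indicator_of_mem, Pi.one_apply]; ring
    · simp [hx, hfU x hx]
  have hquad : ∀ t : ℝ,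
      0 ≤ μ.real U * (t * t) + -2 * (∫ x, f x ∂μ) * t + ∫ x, f x ^ 2 ∂μ := fun t => by
    have hlin : Integrable (fun x => t * t * U.indicator 1 x + -2 * t * f x) μ :=
      (hU_int.const_mul _).add (hf_int.const_mul _)
    have h0 : 0 ≤ ∫ x, (t * U.indicator 1 x - f x) ^ 2 ∂μ := integral_nonneg fun x => sq_nonneg _
    simp only [hexpand] at h0
    rw [integral_add hlin hf.integrable_sq,
      integral_add (hU_int.const_mul _) (hf_int.const_mul _), integral_const_mul,
      integral_const_mul, integral_indicator_one hU] at h0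
    linarith
  have hdiscrim := discrim_le_zero hquad
  rw [discrim] at hdiscrim
  linarith

/-- The Chung–Erdős inequality. -/
theorem sq_sum_measureReal_le {Ω ι : Type*} [MeasurableSpace Ω] (μ : Measure Ω) [IsFiniteMeasure μ]
    (s : Finset ι) {E : ι → Set Ω} (hE : ∀ i, MeasurableSet (E i)) :
    (∑ i ∈ s, μ.real (E i)) ^ 2 ≤
      μ.real (⋃ i ∈ s, E i) * ∑ i ∈ s, ∑ j ∈ s, μ.real (E i ∩ E j) := by
  have hint : ∀ {V : Set Ω}, MeasurableSet V → Integrable (V.indicator (1 : Ω → ℝ)) μ :=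
    fun hV => (integrable_const 1).indicator hV
  let N : Ω → ℝ := fun x => ∑ i ∈ s, (E i).indicator 1 x
  have hN : MemLp N 2 μ := memLp_finsetSum s fun i _ => (memLp_const 1).indicator (hE i)
  have hN_zero : ∀ x ∉ ⋃ i ∈ s, E i, N x = 0 := fun x hx => Finset.sum_eq_zero fun i hi =>
    Set.indicator_of_notMem (fun hxi => hx (Set.mem_biUnion hi hxi)) _
  have hN_mean : ∫ x, N x ∂μ = ∑ i ∈ s, μ.real (E i) := by
    rw [integral_finsetSum _ fun i _ => hint (hE i)]
    exact Finset.sum_congr rfl fun i _ => integral_indicator_one (hE i)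
  have hN_sq : ∀ x, N x ^ 2 = ∑ i ∈ s, ∑ j ∈ s, (E i ∩ E j).indicator 1 x := fun x => by
    simp only [N, sq, Finset.sum_mul_sum, Set.inter_indicator_one, Pi.mul_apply]
  have hN_sq_mean : ∫ x, N x ^ 2 ∂μ = ∑ i ∈ s, ∑ j ∈ s, μ.real (E i ∩ E j) := by
    simp only [hN_sq]
    rw [integral_finsetSum _ fun i _ =>
      integrable_finsetSum _ fun j _ => hint ((hE i).inter (hE j))]
    refine Finset.sum_congr rfl fun i _ => ?_
    rw [integral_finsetSum _ fun j _ => hint ((hE i).inter (hE j))]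
    exact Finset.sum_congr rfl fun j _ => integral_indicator_one ((hE i).inter (hE j))
  rw [← hN_mean, ← hN_sq_mean]
  exact sq_integral_le_measureReal_mul_integral_sq hN
    (Finset.measurableSet_biUnion s fun i _ => hE i) hN_zero

end SecondMoment

section Hypergeometric

/-- The hypergeometric distribution: the probability that a uniformly random `k`-subset of an
`n`-set meets a fixed `k`-subset in exactly `i` points. It is `0` when `n < k`, by division by
zero. -/
noncomputable def hypergeom (n k i : ℕ) : ℝ :=
  k.choose i * (n - k).choose (k - i) / n.choose k

lemma hypergeom_nonneg (n k i : ℕ) : 0 ≤ hypergeom n k i := by unfold hypergeom; positivity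

lemma hypergeom_le_one {n k i : ℕ} (hi : i ≤ k) : hypergeom n k i ≤ 1 := by
  rcases lt_or_ge n k with hk | hk
  · rw [hypergeom, Nat.choose_eq_zero_of_lt hk, Nat.cast_zero, div_zero]
    exact zero_le_one
  refine div_le_one_of_le₀ ?_ (Nat.cast_nonneg _)
  have hvandermonde := Nat.add_choose_eq k (n - k) k
  rw [Nat.add_sub_cancel' hk] at hvandermonde
  rw [hvandermonde]
  exact_mod_cast Finset.single_le_sum (s := Finset.HasAntidiagonal.antidiagonal k) (a := (i, k - i))
    (f := fun ij : ℕ × ℕ => k.choose ij.1 * (n - k).choose ij.2) (fun _ _ => Nat.zero_le _)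
    (Finset.HasAntidiagonal.mem_antidiagonal.2 (Nat.add_sub_cancel' hi))

lemma card_filter_card_inter_eq {α : Type*} [Fintype α] [DecidableEq α] (S : Finset α) {k i : ℕ}
    (hi : i ≤ k) :
    ((Finset.univ.powersetCard k).filter fun S' => (S ∩ S').card = i).card =
      S.card.choose i * (Fintype.card α - S.card).choose (k - i) := by
  rw [← Finset.card_compl, ← Finset.card_powersetCard, ← Finset.card_powersetCard,
    ← Finset.card_product]
  refine Finset.card_nbij' (fun S' => (S ∩ S', S' \ S)) (fun z => z.1 ∪ z.2) ?_ ?_ ?_ ?_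
  · intro S' hS'
    have := Finset.card_inter_add_card_sdiff S' S
    have : S' \ S ⊆ Sᶜ := fun x hx => Finset.mem_compl.2 (Finset.mem_sdiff.1 hx).2
    grind
  · rintro ⟨U, V⟩ hUV
    simp only [Finset.coe_product, Set.mem_prod, Finset.mem_coe, Finset.mem_powersetCard] at hUV
    obtain ⟨⟨hU, hU_card⟩, hV, hV_card⟩ := hUV
    have hdisj : Disjoint U V := disjoint_compl_right.mono hU hV
    have hinter : S ∩ (U ∪ V) = U := by
      rw [Finset.inter_union_distrib_left, Finset.inter_eq_right.2 hU,
        Finset.disjoint_iff_inter_eq_empty.1 (disjoint_compl_right.mono_right hV),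
        Finset.union_empty]
    have hcard : (U ∪ V).card = k := by
      rw [Finset.card_union_of_disjoint hdisj, hU_card, hV_card, Nat.add_sub_cancel' hi]
    simp [hinter, hU_card, hcard]
  · intro S' _
    grind
  · rintro ⟨U, V⟩ hUV
    simp only [Finset.coe_product, Set.mem_prod, Finset.mem_coe, Finset.mem_powersetCard] at hUV
    have hV : ∀ x ∈ V, x ∉ S := fun x hx => Finset.mem_compl.1 (hUV.2.1 hx)
    refine Prod.ext (Finset.ext fun x => ?_) (Finset.ext fun x => ?_) <;> grind

lemma sum_powersetCard_card_inter {α : Type*} [Fintype α] [DecidableEq α] {S : Finset α}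
    {k : ℕ} (hS : S.card = k) (φ : ℕ → ℝ) :
    ∑ S' ∈ Finset.univ.powersetCard k, φ (S ∩ S').card =
      (Fintype.card α).choose k *
        ∑ i ∈ Finset.range (k + 1), hypergeom (Fintype.card α) k i * φ i := by
  have hmaps : ∀ S' ∈ Finset.univ.powersetCard k, (S ∩ S').card ∈ Finset.range (k + 1) :=
    fun S' _ => Finset.mem_range_succ_iff.2 (hS ▸ Finset.card_le_card Finset.inter_subset_left)
  have hpos : ((Fintype.card α).choose k : ℝ) ≠ 0 :=
    Nat.cast_ne_zero.2 (Nat.choose_ne_zero (hS ▸ Finset.card_le_univ S))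
  rw [← Finset.sum_fiberwise_of_maps_to hmaps, Finset.mul_sum]
  refine Finset.sum_congr rfl fun i hi => ?_
  rw [Finset.sum_congr rfl fun S' hS' => by rw [(Finset.mem_filter.1 hS').2], Finset.sum_const,
    nsmul_eq_mul, card_filter_card_inter_eq S (Finset.mem_range_succ_iff.1 hi), hS, hypergeom]
  push_cast
  field_simp

lemma choose_mul_pow_le_choose_mul_pow {k n : ℕ} (hk : k ≤ n) (i : ℕ) :
    k.choose i * n ^ i ≤ n.choose i * k ^ i := by
  induction i with
  | zero => simp
  | succ i ih =>
    have hstep : (k - i) * n ≤ (n - i) * k := by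
      rw [Nat.sub_mul, Nat.sub_mul, mul_comm n k]
      exact Nat.sub_le_sub_left (Nat.mul_le_mul_left i hk) _
    refine Nat.le_of_mul_le_mul_right ?_ i.succ_pos
    calc k.choose (i + 1) * n ^ (i + 1) * (i + 1)
        = k.choose i * n ^ i * ((k - i) * n) := by
          rw [mul_right_comm, Nat.choose_succ_right_eq]; ring
      _ ≤ n.choose i * k ^ i * ((n - i) * k) := Nat.mul_le_mul ih hstep
      _ = n.choose (i + 1) * k ^ (i + 1) * (i + 1) := by
          rw [mul_right_comm _ _ (i + 1), Nat.choose_succ_right_eq]; ring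

lemma hypergeom_le_pow_div_factorial {n k i : ℕ} (hi : i ≤ k) :
    hypergeom n k i ≤ ((k : ℝ) ^ 2 / n) ^ i / i.factorial := by
  rcases lt_or_ge n k with hk | hk
  · rw [hypergeom, Nat.choose_eq_zero_of_lt hk, Nat.cast_zero, div_zero]; positivity
  have hnk : (0 : ℝ) < n.choose k := Nat.cast_pos.2 (Nat.choose_pos hk)
  have hchoose : ((n - k).choose (k - i) : ℝ) * n ^ i ≤ n.choose k * k ^ i := by
    have hni : 0 < n.choose i := Nat.choose_pos (hi.trans hk)
    refine mod_cast Nat.le_of_mul_le_mul_left ?_ hni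
    calc n.choose i * ((n - k).choose (k - i) * n ^ i)
        ≤ n.choose i * ((n - i).choose (k - i) * n ^ i) := by gcongr
      _ = n.choose k * (k.choose i * n ^ i) := by rw [← mul_assoc, ← Nat.choose_mul hi, mul_assoc]
      _ ≤ n.choose k * (n.choose i * k ^ i) := by
          exact Nat.mul_le_mul_left _ (choose_mul_pow_le_choose_mul_pow hk i)
      _ = n.choose i * (n.choose k * k ^ i) := by ring
  rcases n.eq_zero_or_pos with rfl | hn
  · obtain rfl : k = 0 := by omega
    obtain rfl : i = 0 := by omega
    simp [hypergeom]
  have hn' : (0 : ℝ) < n ^ i := by positivity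
  calc hypergeom n k i
      ≤ k.choose i * (k ^ i / n ^ i) := by
        rw [hypergeom, mul_div_assoc]
        refine mul_le_mul_of_nonneg_left ?_ (Nat.cast_nonneg _)
        rwa [div_le_div_iff₀ hnk hn', mul_comm ((k : ℝ) ^ i)]
    _ ≤ k ^ i / i.factorial * (k ^ i / n ^ i) := by
        gcongr
        exact Nat.choose_le_pow_div i k
    _ = ((k : ℝ) ^ 2 / n) ^ i / i.factorial := by rw [div_pow, ← pow_mul]; ring

lemma hypergeom_le_exp_neg {n k i : ℕ} (hik : i ≤ k) {c : ℝ}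
    (hi : Real.exp (c + 1) * ((k : ℝ) ^ 2 / n) ≤ i) : hypergeom n k i ≤ Real.exp (-(c * i)) := by
  have hbase : (k : ℝ) ^ 2 / n ≤ Real.exp (-(c + 1)) * i := by
    rwa [Real.exp_neg, inv_mul_eq_div, le_div_iff₀' (Real.exp_pos _)]
  calc hypergeom n k i ≤ ((k : ℝ) ^ 2 / n) ^ i / i.factorial := hypergeom_le_pow_div_factorial hik
    _ ≤ (Real.exp (-(c + 1)) * i) ^ i / i.factorial := by gcongr
    _ = Real.exp (-(c + 1)) ^ i * ((i : ℝ) ^ i / i.factorial) := by rw [mul_pow, mul_div_assoc]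
    _ ≤ Real.exp (-(c + 1)) ^ i * Real.exp i := by
        gcongr
        exact Real.pow_div_factorial_le_exp _ (Nat.cast_nonneg i) i
    _ = Real.exp (-(c * i)) := by
        rw [← Real.exp_nat_mul, ← Real.exp_add]; ring_nf

lemma mul_mul_le_of_le {M Λ k l i j : ℝ} (hi : 0 < i) (hj : 0 ≤ j) (hik : i ≤ k) (hjl : j ≤ l)
    (hM : 0 ≤ M) (hkl : M * (k * l) ≤ Λ * (k + l)) : M * (i * j) ≤ Λ * (i + j) := by
  have hsum : 0 < k + l := by linarith
  have hmix : i * j * (k + l) ≤ k * l * (i + j) := by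
    nlinarith [mul_le_mul hik hjl hj (hi.le.trans hik), mul_nonneg hi.le (sub_nonneg.2 hjl),
      mul_nonneg hj (sub_nonneg.2 hik)]
  refine le_of_mul_le_mul_right ?_ hsum
  calc M * (i * j) * (k + l) = M * (i * j * (k + l)) := by ring
    _ ≤ M * (k * l * (i + j)) := by gcongr
    _ = M * (k * l) * (i + j) := by ring
    _ ≤ Λ * (k + l) * (i + j) := by gcongr
    _ = Λ * (i + j) * (k + l) := by ring

lemma mul_mul_exp_le_exp {a b x y z w : ℝ} (hb : 0 ≤ b) (hax : a ≤ Real.exp x)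
    (hby : b ≤ Real.exp y) (h : x + y + z ≤ w) : a * b * Real.exp z ≤ Real.exp w := by
  calc a * b * Real.exp z ≤ Real.exp x * Real.exp y * Real.exp z := by gcongr
    _ ≤ Real.exp w := by
      rw [← Real.exp_add, ← Real.exp_add]
      exact Real.exp_le_exp.2 h

/-- If `M * i ≤ 1`, the factor `exp (M * (i * j)) ≤ exp j` is absorbed by the tail of the second
law, and symmetrically if `M * j ≤ 1`. Otherwise the tails are `exp (-(Λ * i))` and
`exp (-(Λ * j))`, and `hkl` passes down from `(k, l)` to `(i, j)` since `i * j / (i + j)` is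
monotone. -/
lemma hypergeom_mul_hypergeom_mul_exp_le {m n k l : ℕ} {M Λ : ℝ} (hM : 0 ≤ M) (hΛ : 1 ≤ Λ)
    (hk : M * (Real.exp (Λ + 1) * ((k : ℝ) ^ 2 / m)) ≤ 1)
    (hl : M * (Real.exp (Λ + 1) * ((l : ℝ) ^ 2 / n)) ≤ 1)
    (hkl : M * (k * l) ≤ Λ * (k + l)) {i j : ℕ} (hi : i ≤ k) (hj : j ≤ l) :
    hypergeom m k i * hypergeom n l j * Real.exp (M * (i * j)) ≤
      Real.exp (M * ((Real.exp 2 * ((k : ℝ) ^ 2 / m)) * (Real.exp 2 * ((l : ℝ) ^ 2 / n)))) := by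
  set R := Real.exp 2 * ((k : ℝ) ^ 2 / m) with hR_def
  set S := Real.exp 2 * ((l : ℝ) ^ 2 / n) with hS_def
  have hRS : 0 ≤ M * (R * S) := by positivity
  have hexp : Real.exp 2 ≤ Real.exp (Λ + 1) := Real.exp_le_exp.2 (by linarith)
  have hR : M * R ≤ 1 := le_trans (by rw [hR_def]; gcongr) hk
  have hS : M * S ≤ 1 := le_trans (by rw [hS_def]; gcongr) hl
  have hj0 : 0 ≤ hypergeom n l j := hypergeom_nonneg n l j
  have hi1 : hypergeom m k i ≤ Real.exp 0 := by simpa using hypergeom_le_one hi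
  have hj1 : hypergeom n l j ≤ Real.exp 0 := by simpa using hypergeom_le_one hj
  have hiR : R ≤ i → hypergeom m k i ≤ Real.exp (-(1 * i)) := fun h =>
    hypergeom_le_exp_neg hi (by norm_num; exact h)
  have hjS : S ≤ j → hypergeom n l j ≤ Real.exp (-(1 * j)) := fun h =>
    hypergeom_le_exp_neg hj (by norm_num; exact h)
  have hmul_i : M * i ≤ 1 → M * (i * j) ≤ j := fun h => by
    rw [← mul_assoc]; exact mul_le_of_le_one_left (Nat.cast_nonneg j) h
  have hmul_j : M * j ≤ 1 → M * (i * j) ≤ i := fun h => by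
    rw [mul_left_comm]; exact mul_le_of_le_one_right (Nat.cast_nonneg i) h
  rcases le_or_gt (i : ℝ) R with cR | cR <;> rcases le_or_gt (j : ℝ) S with cS | cS
  · exact mul_mul_exp_le_exp hj0 hi1 hj1 (by rw [zero_add, zero_add]; gcongr)
  · have := hmul_i (le_trans (by gcongr) hR)
    exact mul_mul_exp_le_exp hj0 hi1 (hjS cS.le) (by linarith)
  · have := hmul_j (le_trans (by gcongr) hS)
    exact mul_mul_exp_le_exp hj0 (hiR cR.le) hj1 (by linarith)
  rcases le_or_gt (M * i) 1 with ci | ci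
  · have := hmul_i ci
    exact mul_mul_exp_le_exp hj0 hi1 (hjS cS.le) (by linarith)
  rcases le_or_gt (M * j) 1 with cj | cj
  · have := hmul_j cj
    exact mul_mul_exp_le_exp hj0 (hiR cR.le) hj1 (by linarith)
  have hiΛ := hypergeom_le_exp_neg hi (lt_of_mul_lt_mul_left (hk.trans_lt ci) hM).le
  have hjΛ := hypergeom_le_exp_neg hj (lt_of_mul_lt_mul_left (hl.trans_lt cj) hM).le
  have := mul_mul_le_of_le (pos_of_mul_pos_right (zero_lt_one.trans ci) hM) j.cast_nonneg
    (Nat.cast_le.2 hi) (Nat.cast_le.2 hj) hM hkl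
  exact mul_mul_exp_le_exp hj0 hiΛ hjΛ (by linarith)

end Hypergeometric

section EmptyRect

/-- The law of a family of independent Bernoulli variables of parameter `p`: the edge indicators of
a random bipartite graph, when `ι` is a product. -/
noncomputable def bernoulliPi (ι : Type*) [Fintype ι] (p : unitInterval) : Measure (ι → Bool) :=
  Measure.pi fun _ => bernoulliMeasure true false p

instance (ι : Type*) [Fintype ι] (p : unitInterval) : IsProbabilityMeasure (bernoulliPi ι p) := by
  unfold bernoulliPi; infer_instance

lemma bernoulliPi_real_forall_eq_false {ι : Type*} [Fintype ι] (p : unitInterval) (F : Finset ι) :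
    (bernoulliPi ι p).real {A | ∀ e ∈ F, A e = false} = (1 - p) ^ F.card := by
  have hpi : {A : ι → Bool | ∀ e ∈ F, A e = false} = (F : Set ι).pi fun _ => {false} := by
    ext; simp
  have hfalse : (bernoulliMeasure true false p).real {false} = 1 - p := by
    rw [bernoulliMeasure_real_apply p (measurableSet_singleton _)]
    simp
  rw [hpi, bernoulliPi, measureReal_def, Measure.pi_pi_finset, ENNReal.toReal_prod]
  simp only [← measureReal_def, hfalse, Finset.prod_const]

variable {ι κ : Type*}

/-- `S × T` contains no edge of the bipartite graph with edge indicators `A`. -/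
def IsEmptyRect (A : ι × κ → Bool) (S : Finset ι) (T : Finset κ) : Prop :=
  ∀ e ∈ S ×ˢ T, A e = false

/-- The bipartite graph with edge indicators `A` has an empty rectangle `S × T` with at least `k`
rows and `l` columns. -/
def HasEmptyRect (A : ι × κ → Bool) (k l : ℕ) : Prop :=
  ∃ S T, k ≤ S.card ∧ l ≤ T.card ∧ IsEmptyRect A S T

lemma IsEmptyRect.mono {A : ι × κ → Bool} {S S' : Finset ι} {T T' : Finset κ}
    (h : IsEmptyRect A S T) (hS : S' ⊆ S) (hT : T' ⊆ T) : IsEmptyRect A S' T' :=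
  fun e he => h e (Finset.product_subset_product hS hT he)

lemma HasEmptyRect.mono {A : ι × κ → Bool} {k k' l l' : ℕ} (h : HasEmptyRect A k l) (hk : k' ≤ k)
    (hl : l' ≤ l) : HasEmptyRect A k' l' := by
  obtain ⟨S, T, hS, hT, hE⟩ := h
  exact ⟨S, T, hk.trans hS, hl.trans hT, hE⟩

variable [Fintype ι] [Fintype κ]

/-- The pairs of a `k`-subset of `ι` and an `l`-subset of `κ`. -/
def rects (ι κ : Type*) [Fintype ι] [Fintype κ] (k l : ℕ) : Finset (Finset ι × Finset κ) :=
  Finset.univ.powersetCard k ×ˢ Finset.univ.powersetCard l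

lemma mem_rects {k l : ℕ} {z : Finset ι × Finset κ} :
    z ∈ rects ι κ k l ↔ z.1.card = k ∧ z.2.card = l := by
  simp [rects, Finset.mem_powersetCard]

lemma card_rects (k l : ℕ) :
    (rects ι κ k l).card = (Fintype.card ι).choose k * (Fintype.card κ).choose l := by
  simp [rects]

lemma setOf_hasEmptyRect (k l : ℕ) : {A : ι × κ → Bool | HasEmptyRect A k l} =
    ⋃ z ∈ rects ι κ k l, {A | IsEmptyRect A z.1 z.2} := by
  ext A
  simp only [Set.mem_iUnion, Set.mem_ofPred_eq, exists_prop, mem_rects]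
  constructor
  · rintro ⟨S, T, hS, hT, hE⟩
    obtain ⟨S', hS', hS'_card⟩ := Finset.exists_subset_card_eq hS
    obtain ⟨T', hT', hT'_card⟩ := Finset.exists_subset_card_eq hT
    exact ⟨(S', T'), ⟨hS'_card, hT'_card⟩, hE.mono hS' hT'⟩
  · rintro ⟨⟨S, T⟩, ⟨hS, hT⟩, hE⟩
    exact ⟨S, T, hS.ge, hT.ge, hE⟩

lemma bernoulliPi_real_isEmptyRect (p : unitInterval) (S : Finset ι) (T : Finset κ) :
    (bernoulliPi (ι × κ) p).real {A | IsEmptyRect A S T} = (1 - p) ^ (S.card * T.card) := by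
  rw [← Finset.card_product]
  exact bernoulliPi_real_forall_eq_false p _

lemma bernoulliPi_real_isEmptyRect_inter [DecidableEq ι] [DecidableEq κ] {p : unitInterval}
    (hp : p < 1) (S S' : Finset ι) (T T' : Finset κ) :
    (bernoulliPi (ι × κ) p).real ({A | IsEmptyRect A S T} ∩ {A | IsEmptyRect A S' T'}) =
      (1 - p) ^ (S.card * T.card) * (1 - p) ^ (S'.card * T'.card) *
        (1 - p : ℝ)⁻¹ ^ ((S ∩ S').card * (T ∩ T').card) := by
  have hunion : ({A : ι × κ → Bool | IsEmptyRect A S T} ∩ {A | IsEmptyRect A S' T'}) =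
      {A | ∀ e ∈ S ×ˢ T ∪ S' ×ˢ T', A e = false} := by
    ext; exact Finset.forall_mem_union.symm
  have hcard := Finset.card_union_add_card_inter (S ×ˢ T) (S' ×ˢ T')
  simp only [Finset.product_inter_product, Finset.card_product] at hcard
  have hq : (1 - p : ℝ) ≠ 0 := (sub_pos.2 hp : (0 : ℝ) < 1 - p).ne'
  rw [hunion, bernoulliPi_real_forall_eq_false, ← pow_add, ← hcard, pow_add, mul_assoc, ← mul_pow,
    mul_inv_cancel₀ hq, one_pow, mul_one]

lemma bernoulliPi_real_hasEmptyRect_le (p : unitInterval) (k l : ℕ) :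
    (bernoulliPi (ι × κ) p).real {A | HasEmptyRect A k l} ≤
      (Fintype.card ι).choose k * (Fintype.card κ).choose l * (1 - p) ^ (k * l) := by
  calc (bernoulliPi (ι × κ) p).real {A | HasEmptyRect A k l}
      ≤ ∑ z ∈ rects ι κ k l, (bernoulliPi (ι × κ) p).real {A | IsEmptyRect A z.1 z.2} := by
        rw [setOf_hasEmptyRect]
        exact measureReal_biUnion_finset_le _ _
    _ = ∑ _z ∈ rects ι κ k l, (1 - p : ℝ) ^ (k * l) := by
        refine Finset.sum_congr rfl fun z hz => ?_
        rw [bernoulliPi_real_isEmptyRect, (mem_rects.1 hz).1, (mem_rects.1 hz).2]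
    _ = _ := by rw [Finset.sum_const, card_rects, nsmul_eq_mul, Nat.cast_mul]

lemma sum_rects_pow_card_inter [DecidableEq ι] [DecidableEq κ] {k l : ℕ} {S : Finset ι}
    {T : Finset κ} (hS : S.card = k) (hT : T.card = l) (x : ℝ) :
    ∑ z ∈ rects ι κ k l, x ^ ((S ∩ z.1).card * (T ∩ z.2).card) =
      (rects ι κ k l).card * ∑ i ∈ Finset.range (k + 1), ∑ j ∈ Finset.range (l + 1),
        hypergeom (Fintype.card ι) k i * hypergeom (Fintype.card κ) l j * x ^ (i * j) := by
  rw [card_rects, rects, Finset.sum_product, Finset.sum_congr rfl fun S' _ =>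
    sum_powersetCard_card_inter hT fun j => x ^ ((S ∩ S').card * j),
    sum_powersetCard_card_inter hS fun i => (Fintype.card κ).choose l *
    ∑ j ∈ Finset.range (l + 1), hypergeom (Fintype.card κ) l j * x ^ (i * j)]
  simp only [Nat.cast_mul, Finset.mul_sum]
  refine Finset.sum_congr rfl fun i _ => Finset.sum_congr rfl fun j _ => ?_
  ring

theorem one_le_bernoulliPi_real_hasEmptyRect_mul_sum {p : unitInterval} (hp : p < 1) {k l : ℕ}
    (hk : k ≤ Fintype.card ι) (hl : l ≤ Fintype.card κ) :
    1 ≤ (bernoulliPi (ι × κ) p).real {A | HasEmptyRect A k l} *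
      ∑ i ∈ Finset.range (k + 1), ∑ j ∈ Finset.range (l + 1),
        hypergeom (Fintype.card ι) k i * hypergeom (Fintype.card κ) l j *
          (1 - p : ℝ)⁻¹ ^ (i * j) := by
  classical
  set H := ∑ i ∈ Finset.range (k + 1), ∑ j ∈ Finset.range (l + 1),
    hypergeom (Fintype.card ι) k i * hypergeom (Fintype.card κ) l j * (1 - p : ℝ)⁻¹ ^ (i * j)
  set q : ℝ := (1 - p) ^ (k * l)
  set N : ℝ := ((rects ι κ k l).card : ℝ) with hN_def
  have hq : 0 < q := pow_pos (sub_pos.2 hp : (0 : ℝ) < 1 - p) _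
  have hN : 0 < N := by
    rw [hN_def, card_rects]
    exact_mod_cast Nat.mul_pos (Nat.choose_pos hk) (Nat.choose_pos hl)
  have hfirst : ∑ z ∈ rects ι κ k l, (bernoulliPi (ι × κ) p).real {A | IsEmptyRect A z.1 z.2} =
      N * q := by
    rw [hN_def, ← nsmul_eq_mul, ← Finset.sum_const]
    refine Finset.sum_congr rfl fun z hz => ?_
    rw [bernoulliPi_real_isEmptyRect, (mem_rects.1 hz).1, (mem_rects.1 hz).2]
  have hsecond : ∑ z ∈ rects ι κ k l, ∑ z' ∈ rects ι κ k l, (bernoulliPi (ι × κ) p).real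
      ({A | IsEmptyRect A z.1 z.2} ∩ {A | IsEmptyRect A z'.1 z'.2}) = (N * q) ^ 2 * H := by
    calc _ = ∑ _z ∈ rects ι κ k l, q * q * (N * H) := by
          refine Finset.sum_congr rfl fun z hz => ?_
          obtain ⟨hz₁, hz₂⟩ := mem_rects.1 hz
          rw [← sum_rects_pow_card_inter hz₁ hz₂, Finset.mul_sum]
          refine Finset.sum_congr rfl fun z' hz' => ?_
          rw [bernoulliPi_real_isEmptyRect_inter hp, hz₁, hz₂, (mem_rects.1 hz').1,
            (mem_rects.1 hz').2]
      _ = (N * q) ^ 2 * H := by rw [Finset.sum_const, nsmul_eq_mul]; ring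
  have hCE := sq_sum_measureReal_le (bernoulliPi (ι × κ) p) (rects ι κ k l)
    (E := fun z => {A | IsEmptyRect A z.1 z.2}) fun z => MeasurableSet.of_discrete
  rw [← setOf_hasEmptyRect, hfirst, hsecond] at hCE
  refine le_of_mul_le_mul_left ?_ (pow_pos (mul_pos hN hq) 2)
  linarith

theorem one_le_mul_exp_mul_bernoulliPi_real_hasEmptyRect {p : unitInterval} (hp : p < 1) {k l : ℕ}
    (hk : k ≤ Fintype.card ι) (hl : l ≤ Fintype.card κ) {M Λ : ℝ} (hM : 0 ≤ M) (hΛ : 1 ≤ Λ)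
    (hpM : (1 - p : ℝ)⁻¹ ≤ Real.exp M)
    (hkM : M * (Real.exp (Λ + 1) * ((k : ℝ) ^ 2 / Fintype.card ι)) ≤ 1)
    (hlM : M * (Real.exp (Λ + 1) * ((l : ℝ) ^ 2 / Fintype.card κ)) ≤ 1)
    (hkl : M * (k * l) ≤ Λ * (k + l)) :
    1 ≤ (k + 1) * (l + 1) * Real.exp (M * ((Real.exp 2 * ((k : ℝ) ^ 2 / Fintype.card ι)) *
      (Real.exp 2 * ((l : ℝ) ^ 2 / Fintype.card κ)))) *
        (bernoulliPi (ι × κ) p).real {A | HasEmptyRect A k l} := by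
  set B := Real.exp (M * ((Real.exp 2 * ((k : ℝ) ^ 2 / Fintype.card ι)) *
    (Real.exp 2 * ((l : ℝ) ^ 2 / Fintype.card κ))))
  have hq : 0 ≤ (1 - p : ℝ)⁻¹ := inv_nonneg.2 (sub_nonneg.2 p.2.2)
  have hterm : ∀ i ∈ Finset.range (k + 1), ∀ j ∈ Finset.range (l + 1),
      hypergeom (Fintype.card ι) k i * hypergeom (Fintype.card κ) l j * (1 - p : ℝ)⁻¹ ^ (i * j) ≤
        B := fun i hi j hj => by
    refine le_trans ?_ (hypergeom_mul_hypergeom_mul_exp_le hM hΛ hkM hlM hkl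
      (Finset.mem_range_succ_iff.1 hi) (Finset.mem_range_succ_iff.1 hj))
    refine mul_le_mul_of_nonneg_left ?_ (mul_nonneg (hypergeom_nonneg _ _ _)
      (hypergeom_nonneg _ _ _))
    rw [mul_comm M, ← Nat.cast_mul, Real.exp_nat_mul]
    exact pow_le_pow_left₀ hq hpM _
  calc (1 : ℝ) ≤ _ := one_le_bernoulliPi_real_hasEmptyRect_mul_sum hp hk hl
    _ ≤ (bernoulliPi (ι × κ) p).real {A | HasEmptyRect A k l} *
          ∑ i ∈ Finset.range (k + 1), ∑ _j ∈ Finset.range (l + 1), B := by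
        gcongr with i hi j hj
        exact hterm i hi j hj
    _ = _ := by
        simp only [Finset.sum_const, Finset.card_range, nsmul_eq_mul]
        push_cast
        ring

end EmptyRect

section Concentration

lemma measurePreserving_curry_bernoulliPi (ι κ : Type*) [Fintype ι] [Fintype κ]
    (p : unitInterval) :
    MeasurePreserving Function.curry (bernoulliPi (ι × κ) p)
      (Measure.pi fun _ : ι => bernoulliPi κ p) := by
  refine MeasurePreserving.symm (MeasurableEquiv.curry ι κ Bool).symm
    ⟨MeasurableEquiv.measurable _, (Measure.pi_eq fun s _ => ?_).symm⟩
  have hpreimage : (MeasurableEquiv.curry ι κ Bool).symm ⁻¹' Set.univ.pi s =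
      Set.univ.pi fun i => Set.univ.pi fun j => s (i, j) := by
    ext x
    simp [MeasurableEquiv.curry]
  rw [MeasurableEquiv.map_apply, hpreimage, Measure.pi_pi, Fintype.prod_prod_type]
  exact Finset.prod_congr rfl fun i _ => Measure.pi_pi _ _

variable {ι κ : Type*} [Fintype ι]

/-- The common non-neighbours of `T` in the bipartite graph with edge indicators `A`. -/
def nonNbrs (A : ι × κ → Bool) (T : Finset κ) : Finset ι :=
  Finset.univ.filter fun i => ∀ j ∈ T, A (i, j) = false

lemma isEmptyRect_iff_subset_nonNbrs {A : ι × κ → Bool} {S : Finset ι} {T : Finset κ} :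
    IsEmptyRect A S T ↔ S ⊆ nonNbrs A T := by
  simp only [IsEmptyRect, nonNbrs, Finset.mem_product, Prod.forall, Finset.subset_iff,
    Finset.mem_filter_univ]
  exact ⟨fun h i hi j hj => h i j ⟨hi, hj⟩, fun h i j hij => h hij.1 j hij.2⟩

variable [Fintype κ]

/-- The largest number of common non-neighbours of an `l`-set. -/
def maxNonNbrs (l : ℕ) (A : ι × κ → Bool) : ℕ :=
  (Finset.univ.powersetCard l).sup fun T => (nonNbrs A T).card

lemma hasEmptyRect_iff_le_maxNonNbrs {A : ι × κ → Bool} {k l : ℕ} (hl : l ≤ Fintype.card κ) :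
    HasEmptyRect A k l ↔ k ≤ maxNonNbrs l A := by
  constructor
  · rintro ⟨S, T, hS, hT, hE⟩
    obtain ⟨T', hT', hT'_card⟩ := Finset.exists_subset_card_eq hT
    calc k ≤ S.card := hS
      _ ≤ (nonNbrs A T').card :=
        Finset.card_le_card (isEmptyRect_iff_subset_nonNbrs.1 (hE.mono subset_rfl hT'))
      _ ≤ maxNonNbrs l A := Finset.le_sup (f := fun T => (nonNbrs A T).card)
        (Finset.mem_powersetCard.2 ⟨Finset.subset_univ T', hT'_card⟩)
  · intro hk
    have hne : (Finset.univ.powersetCard l : Finset (Finset κ)).Nonempty :=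
      Finset.powersetCard_nonempty.2 hl
    obtain ⟨T, hT, hmax⟩ := Finset.exists_mem_eq_sup _ hne fun T => (nonNbrs A T).card
    exact ⟨nonNbrs A T, T, hk.trans_eq hmax, (Finset.mem_powersetCard.1 hT).2.ge,
      isEmptyRect_iff_subset_nonNbrs.2 subset_rfl⟩

lemma maxNonNbrs_le_add_one (l : ℕ) {A A' : ι × κ → Bool} (i : ι)
    (h : ∀ i' ≠ i, ∀ j, A (i', j) = A' (i', j)) : maxNonNbrs l A ≤ maxNonNbrs l A' + 1 := by
  classical
  refine Finset.sup_le fun T hT => ?_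
  have hsub : nonNbrs A T ⊆ insert i (nonNbrs A' T) := fun i' hi' => by
    rcases eq_or_ne i' i with rfl | hne
    · exact Finset.mem_insert_self _ _
    · simpa [nonNbrs, hne, h i' hne] using hi'
  calc (nonNbrs A T).card ≤ (insert i (nonNbrs A' T)).card := Finset.card_le_card hsub
    _ ≤ (nonNbrs A' T).card + 1 := Finset.card_insert_le _ _
    _ ≤ maxNonNbrs l A' + 1 :=
      Nat.add_le_add_right (Finset.le_sup (f := fun T => (nonNbrs A' T).card) hT) 1

lemma dist_maxNonNbrs_update_le [DecidableEq ι] (l : ℕ) (x : ι → κ → Bool) (i : ι)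
    (r : κ → Bool) : dist (maxNonNbrs l (Function.uncurry (Function.update x i r)) : ℝ)
      (maxNonNbrs l (Function.uncurry x)) ≤ 1 := by
  have hrow : ∀ i' ≠ i, ∀ j, Function.uncurry (Function.update x i r) (i', j) =
      Function.uncurry x (i', j) := fun i' hi' j => by
    simp [hi']
  have hle : (maxNonNbrs l (Function.uncurry (Function.update x i r)) : ℝ) ≤
      maxNonNbrs l (Function.uncurry x) + 1 := mod_cast maxNonNbrs_le_add_one l i hrow
  have hge : (maxNonNbrs l (Function.uncurry x) : ℝ) ≤
      maxNonNbrs l (Function.uncurry (Function.update x i r)) + 1 :=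
    mod_cast maxNonNbrs_le_add_one l i fun i' hi' j => (hrow i' hi' j).symm
  rw [Real.dist_eq, abs_sub_le_iff]
  constructor <;> linarith

theorem bernoulliPi_real_hasEmptyRect_mul_real_not_le {n : ℕ} (p : unitInterval) {k l : ℕ}
    (hl : l ≤ Fintype.card κ) {v : ℝ} (hv : v ≤ k) :
    (bernoulliPi (Fin n × κ) p).real {A | HasEmptyRect A k l} *
        (bernoulliPi (Fin n × κ) p).real {A | ¬ HasEmptyRect A ⌈v⌉₊ l} ≤
      Real.exp (-(k - v) ^ 2 / (2 * n)) := by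
  have hmp := measurePreserving_curry_bernoulliPi (Fin n) κ p
  have hsub := hasSubgaussianMGF_sub_integral_pi (fun _ : Fin n => bernoulliPi κ p)
    (f := fun x => (maxNonNbrs l (Function.uncurry x) : ℝ)) (c := fun _ => 1)
    (measurable_of_finite _) (dist_maxNonNbrs_update_le l)
  rw [← hmp.map_eq] at hsub
  have hsub' := hsub.of_map hmp.aemeasurable
  have htail := measureReal_ge_mul_measureReal_le_le (f := fun A => (maxNonNbrs l A : ℝ)) hsub' hv
  have hvar : 8 * ((∑ _i : Fin n, ((1 : NNReal) / 2) ^ 2 : NNReal) : ℝ) = 2 * n := by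
    simp; ring
  rw [hvar] at htail
  refine le_trans (mul_le_mul ?_ ?_ measureReal_nonneg measureReal_nonneg) htail
  · refine measureReal_mono fun A hA => ?_
    rw [Set.mem_ofPred_eq, hasEmptyRect_iff_le_maxNonNbrs hl] at hA
    exact (Nat.cast_le (α := ℝ)).2 hA
  · refine measureReal_mono fun A hA => ?_
    rw [Set.mem_ofPred_eq, hasEmptyRect_iff_le_maxNonNbrs hl, Nat.ceil_le, not_le] at hA
    exact hA.le

end Concentration

section IndependentSets

variable {n : ℕ} {G : SimpleGraph (Vertex n)} {I : Finset (Vertex n)} {γ s t : ℝ}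

/-- The graph has an independent set with at least `s` vertices in `L` and at least `t` vertices
in `R`. -/
def HasIndepSet (G : SimpleGraph (Vertex n)) (s t : ℝ) : Prop :=
  ∃ I : Finset (Vertex n), G.IsIndepSet (I : Set (Vertex n)) ∧
    s ≤ I.toLeft.card ∧ t ≤ I.toRight.card

lemma HasIndepSet.mono {s' t' : ℝ} (h : HasIndepSet G s t) (hs : s' ≤ s) (ht : t' ≤ t) :
    HasIndepSet G s' t' := by
  obtain ⟨I, hI, hsI, htI⟩ := h
  exact ⟨I, hI, hs.trans hsI, ht.trans htI⟩

lemma isIndepSet_bipGraph_iff {A : Fin n × Fin n → Bool} :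
    (bipGraph A).IsIndepSet (I : Set (Vertex n)) ↔ IsEmptyRect A I.toLeft I.toRight := by
  constructor
  · rintro h ⟨i, j⟩ hij
    obtain ⟨hi, hj⟩ := Finset.mem_product.1 hij
    have := h (Finset.mem_coe.2 (Finset.mem_toLeft.1 hi))
      (Finset.mem_coe.2 (Finset.mem_toRight.1 hj)) Sum.inl_ne_inr
    simpa [bipGraph] using this
  · rintro h (i | i) hi (j | j) hj - hadj
    · exact hadj
    · simp [bipGraph, h (i, j) (by simp_all)] at hadj
    · simp [bipGraph, h (j, i) (by simp_all)] at hadj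
    · exact hadj

lemma hasIndepSet_bipGraph_iff {A : Fin n × Fin n → Bool} :
    HasIndepSet (bipGraph A) s t ↔ HasEmptyRect A ⌈s⌉₊ ⌈t⌉₊ := by
  constructor
  · rintro ⟨I, hI, hs, ht⟩
    exact ⟨I.toLeft, I.toRight, Nat.ceil_le.2 hs, Nat.ceil_le.2 ht, isIndepSet_bipGraph_iff.1 hI⟩
  · rintro ⟨S, T, hS, hT, hST⟩
    refine ⟨S.disjSum T, isIndepSet_bipGraph_iff.2 ?_, ?_, ?_⟩
    · rwa [Finset.toLeft_disjSum, Finset.toRight_disjSum]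
    · rw [Finset.toLeft_disjSum]
      exact Nat.ceil_le.1 hS
    · rw [Finset.toRight_disjSum]
      exact Nat.ceil_le.1 hT

lemma HasIndepSet.exists_card_eq_ceil (h : HasIndepSet G s t) :
    ∃ I : Finset (Vertex n), G.IsIndepSet (I : Set (Vertex n)) ∧
      I.toLeft.card = ⌈s⌉₊ ∧ I.toRight.card = ⌈t⌉₊ := by
  obtain ⟨I, hI, hs, ht⟩ := h
  obtain ⟨S, hS, hSc⟩ := Finset.exists_subset_card_eq (Nat.ceil_le.2 hs)
  obtain ⟨T, hT, hTc⟩ := Finset.exists_subset_card_eq (Nat.ceil_le.2 ht)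
  have hsub : S.disjSum T ⊆ I := by
    rw [← Finset.toLeft_disjSum_toRight (u := I)]
    exact Finset.disjSum_mono hS hT
  refine ⟨S.disjSum T, hI.mono (Finset.coe_subset.2 hsub), ?_, ?_⟩
  · rwa [Finset.toLeft_disjSum]
  · rwa [Finset.toRight_disjSum]

lemma cast_card_eq_toLeft_add_toRight (I : Finset (Vertex n)) :
    (I.card : ℝ) = I.toLeft.card + I.toRight.card := by
  exact_mod_cast Finset.card_toLeft_add_card_toRight.symm

lemma IsGammaBalancedIndep.card_le_maxGammaBalanced (h : IsGammaBalancedIndep γ G I) :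
    I.card ≤ maxGammaBalanced γ G :=
  Finset.le_sup (f := Finset.card) (by simpa using h)

lemma IsBalancedIndep.card_le_maxBalanced (h : IsBalancedIndep G I) : I.card ≤ maxBalanced G :=
  Finset.le_sup (f := Finset.card) (by simpa using h)

lemma exists_card_eq_maxGammaBalanced (γ : ℝ) (G : SimpleGraph (Vertex n)) :
    ∃ I, IsGammaBalancedIndep γ G I ∧ I.card = maxGammaBalanced γ G := by
  classical
  have hempty : IsGammaBalancedIndep γ G ∅ := by
    simp [IsGammaBalancedIndep, Finset.toLeft, SimpleGraph.IsIndepSet]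
  obtain ⟨I, hI, hmax⟩ := Finset.exists_mem_eq_sup
    (Finset.univ.filter (IsGammaBalancedIndep γ G)) ⟨∅, by simpa using hempty⟩ Finset.card
  exact ⟨I, (Finset.mem_filter.1 hI).2, hmax.symm⟩

lemma maxBalanced_le_maxGammaBalanced (G : SimpleGraph (Vertex n)) :
    maxBalanced G ≤ maxGammaBalanced (1 / 2) G := by
  classical
  refine Finset.sup_mono (Finset.monotone_filter_right _ fun I _ hI => ⟨hI.1, ?_⟩)
  have hcard : (I.toLeft.card : ℝ) = I.toRight.card := by exact_mod_cast hI.2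
  rw [cast_card_eq_toLeft_add_toRight, ← hcard]
  ring_nf
  norm_num

lemma HasIndepSet.of_le_maxGammaBalanced (hγ : 0 ≤ γ) (hγ1 : γ ≤ 1)
    (h : s ≤ maxGammaBalanced γ G) : HasIndepSet G (γ * s - 1) ((1 - γ) * s - 1) := by
  obtain ⟨I, ⟨hI, hbal⟩, hcard⟩ := exists_card_eq_maxGammaBalanced γ G
  rw [← hcard] at h
  have hL := mul_le_mul_of_nonneg_left h hγ
  have hR := mul_le_mul_of_nonneg_left h (sub_nonneg.2 hγ1)
  have hadd := cast_card_eq_toLeft_add_toRight I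
  rw [abs_lt] at hbal
  exact ⟨I, hI, by linarith, by linarith⟩

lemma HasIndepSet.sub_two_le_maxGammaBalanced (hγ : 0 < γ) (hγ1 : γ < 1) (hs : 0 < s)
    (h : HasIndepSet G (γ * s - 1) ((1 - γ) * s - 1)) : s - 2 ≤ maxGammaBalanced γ G := by
  obtain ⟨I, hI, hL, hR⟩ := h.exists_card_eq_ceil
  have hγ' : 0 < 1 - γ := sub_pos.2 hγ1
  have hL1 : γ * s - 1 ≤ I.toLeft.card := hL ▸ Nat.le_ceil _
  have hR1 : (1 - γ) * s - 1 ≤ I.toRight.card := hR ▸ Nat.le_ceil _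
  have hL2 : (I.toLeft.card : ℝ) < γ * s - 1 + 1 :=
    hL ▸ Nat.ceil_lt_add_one_of_gt_neg_one (by linarith [mul_pos hγ hs])
  have hR2 : (I.toRight.card : ℝ) < (1 - γ) * s - 1 + 1 :=
    hR ▸ Nat.ceil_lt_add_one_of_gt_neg_one (by linarith [mul_pos hγ' hs])
  have hcard := cast_card_eq_toLeft_add_toRight I
  have hbal : IsGammaBalancedIndep γ G I := by
    refine ⟨hI, ?_⟩
    rw [hcard, abs_lt]
    constructor <;> nlinarith
  have hmax : (I.card : ℝ) ≤ maxGammaBalanced γ G := by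
    exact_mod_cast hbal.card_le_maxGammaBalanced
  linarith

lemma HasIndepSet.two_mul_le_maxBalanced (h : HasIndepSet G s s) : 2 * s ≤ maxBalanced G := by
  obtain ⟨I, hI, hL, hR⟩ := h.exists_card_eq_ceil
  have hbal : IsBalancedIndep G I := ⟨hI, hL.trans hR.symm⟩
  have hmax : (I.card : ℝ) ≤ maxBalanced G := by exact_mod_cast hbal.card_le_maxBalanced
  rw [cast_card_eq_toLeft_add_toRight, hL, hR] at hmax
  linarith [Nat.le_ceil s]

end IndependentSets

section HighProbability

variable {d : ℝ} {P Q : ∀ n : ℕ, SimpleGraph (Vertex n) → Prop}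

lemma bipLaw_eq_bernoulliPi (n : ℕ) (d : ℝ) :
    bipLaw n d = bernoulliPi (Fin n × Fin n) (edgeProb n d) := rfl

instance (n : ℕ) (d : ℝ) : IsProbabilityMeasure (bipLaw n d) := by
  rw [bipLaw_eq_bernoulliPi]
  infer_instance

lemma Whp.mono (h : Whp d P) (hPQ : ∀ᶠ n in atTop, ∀ G, P n G → Q n G) : Whp d Q := by
  refine tendsto_of_tendsto_of_tendsto_of_le_of_le' h tendsto_const_nhds ?_
    (Eventually.of_forall fun n => measureReal_le_one)
  filter_upwards [hPQ] with n hn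
  exact measureReal_mono fun A hA => hn (bipGraph A) hA

lemma whp_not_iff :
    Whp d (fun n G => ¬ P n G) ↔
      Tendsto (fun n => (bipLaw n d).real {A | P n (bipGraph A)}) atTop (𝓝 0) := by
  have hcompl (n : ℕ) : (bipLaw n d).real {A | ¬ P n (bipGraph A)} =
      1 - (bipLaw n d).real {A | P n (bipGraph A)} :=
    probReal_compl_eq_one_sub MeasurableSet.of_discrete
  simp only [Whp, hcompl]
  constructor <;> intro h <;> simpa using h.const_sub 1

lemma Whp.and (hP : Whp d P) (hQ : Whp d Q) : Whp d fun n G => P n G ∧ Q n G := by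
  have hlim : Tendsto (fun n => (bipLaw n d).real {A | P n (bipGraph A)} +
      (bipLaw n d).real {A | Q n (bipGraph A)} - 1) atTop (𝓝 1) := by
    simpa using (Tendsto.add hP hQ).sub_const 1
  refine tendsto_of_tendsto_of_tendsto_of_le_of_le hlim tendsto_const_nhds (fun n => ?_)
    (fun n => measureReal_le_one)
  have hadd := measureReal_union_add_inter (μ := bipLaw n d) (s := {A | P n (bipGraph A)})
    (t := {A | Q n (bipGraph A)}) MeasurableSet.of_discrete
  have hunion : (bipLaw n d).real ({A | P n (bipGraph A)} ∪ {A | Q n (bipGraph A)}) ≤ 1 :=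
    measureReal_le_one
  simp only [← Set.ofPred_and] at hadd ⊢
  linarith

end HighProbability

section EdgeProbability

variable {d D : ℝ}

lemma eventually_edgeProb_eq (hd : 0 ≤ d) : ∀ᶠ n : ℕ in atTop, (edgeProb n d : ℝ) = d / n := by
  filter_upwards [tendsto_natCast_atTop_atTop.eventually_ge_atTop d] with n hn
  exact congrArg Subtype.val
    (Set.projIcc_of_mem zero_le_one ⟨by positivity, div_le_one_of_le₀ hn n.cast_nonneg⟩)

lemma eventually_inv_one_sub_edgeProb_le (hd : 0 ≤ d) (hD : d < D) :
    ∀ᶠ n : ℕ in atTop, edgeProb n d < 1 ∧ (1 - edgeProb n d : ℝ)⁻¹ ≤ Real.exp (D / n) := by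
  filter_upwards [eventually_edgeProb_eq hd, eventually_gt_atTop 0,
    tendsto_natCast_atTop_atTop.eventually_ge_atTop (d * D / (D - d))] with n hp hn hnD
  have hmul : 1 ≤ (1 - d / n) * (1 + D / n) := by
    have hdD : d * D ≤ n * (D - d) := (div_le_iff₀ (sub_pos.2 hD)).1 hnD
    have hexpand : (1 - d / n) * (1 + D / n) = 1 + (n * (D - d) - d * D) / (n : ℝ) ^ 2 := by
      field_simp
      ring
    rw [hexpand, le_add_iff_nonneg_right]
    exact div_nonneg (sub_nonneg.2 hdD) (by positivity)
  have hD0 : 0 < 1 + D / n := by have := hd.trans_lt hD; positivity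
  have hpos : 0 < 1 - d / (n : ℝ) := pos_of_mul_pos_left (zero_lt_one.trans_le hmul) hD0.le
  constructor
  · rw [← Subtype.coe_lt_coe, hp]
    exact sub_pos.1 hpos
  · rw [hp, inv_le_iff_one_le_mul₀' hpos]
    refine hmul.trans (mul_le_mul_of_nonneg_left ?_ hpos.le)
    linarith [Real.add_one_le_exp (D / n)]

end EdgeProbability

section Supercritical

lemma choose_le_exp_mul_add_negMulLog {n k : ℕ} {a : ℝ} (ha : 0 < a) (ha1 : a ≤ 1)
    (hk : k ≤ a * n) : (n.choose k : ℝ) ≤ Real.exp (n * (a + Real.negMulLog a)) := by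
  have hchoose : (n.choose k : ℝ) * a ^ k ≤ Real.exp (n * a) := by
    refine le_trans ?_ (Real.pow_div_factorial_le_exp _ (by positivity) k)
    rw [mul_pow, mul_div_right_comm]
    exact mul_le_mul_of_nonneg_right (Nat.choose_le_pow_div k n) (by positivity)
  have hpow : (a ^ k)⁻¹ ≤ Real.exp (n * Real.negMulLog a) := by
    rw [← Real.exp_log (pow_pos ha k), ← Real.exp_neg, Real.exp_le_exp, Real.log_pow,
      Real.negMulLog]
    linarith [mul_le_mul_of_nonpos_right hk (Real.log_nonpos ha.le ha1)]
  calc (n.choose k : ℝ) = n.choose k * a ^ k * (a ^ k)⁻¹ :=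
        (mul_inv_cancel_right₀ (pow_ne_zero k ha.ne') _).symm
    _ ≤ Real.exp (n * a) * Real.exp (n * Real.negMulLog a) :=
        mul_le_mul hchoose hpow (by positivity) (Real.exp_pos _).le
    _ = Real.exp (n * (a + Real.negMulLog a)) := by rw [← Real.exp_add, mul_add]

lemma bernoulliPi_real_hasEmptyRect_ceil_le {n : ℕ} {p : unitInterval} {a b : ℝ} (ha1 : a ≤ 1)
    (hb1 : b ≤ 1) (han : 1 ≤ a * n) (hbn : 1 ≤ b * n) :
    (bernoulliPi (Fin n × Fin n) p).real {A | HasEmptyRect A ⌈a * n - 1⌉₊ ⌈b * n - 1⌉₊} ≤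
      Real.exp (n * (a + Real.negMulLog a + (b + Real.negMulLog b)) -
        p * ((a * n - 1) * (b * n - 1))) := by
  have hchoose {c : ℝ} (hc1 : c ≤ 1) (hcn : 1 ≤ c * n) :
      (n.choose ⌈c * n - 1⌉₊ : ℝ) ≤ Real.exp (n * (c + Real.negMulLog c)) := by
    refine choose_le_exp_mul_add_negMulLog
      (pos_of_mul_pos_left (zero_lt_one.trans_le hcn) n.cast_nonneg) hc1 ?_
    linarith [Nat.ceil_lt_add_one (sub_nonneg.2 hcn)]
  have hp0 : 0 ≤ 1 - (p : ℝ) := sub_nonneg.2 p.2.2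
  set k := ⌈a * n - 1⌉₊
  set l := ⌈b * n - 1⌉₊
  have hkl : (a * n - 1) * (b * n - 1) ≤ (k : ℝ) * l :=
    mul_le_mul (Nat.le_ceil _) (Nat.le_ceil _) (sub_nonneg.2 hbn) k.cast_nonneg
  have hpow : (1 - p : ℝ) ^ (k * l) ≤ Real.exp (-(p * ((a * n - 1) * (b * n - 1)))) := by
    calc (1 - p : ℝ) ^ (k * l) ≤ Real.exp (-p) ^ (k * l) :=
          pow_le_pow_left₀ hp0 (Real.one_sub_le_exp_neg _) _
      _ = Real.exp (-(p * (k * l))) := by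
          rw [← Real.exp_nat_mul]
          push_cast
          ring_nf
      _ ≤ _ := Real.exp_le_exp.2 (neg_le_neg (mul_le_mul_of_nonneg_left hkl p.2.1))
  have hunion := bernoulliPi_real_hasEmptyRect_le (ι := Fin n) (κ := Fin n) p k l
  rw [Fintype.card_fin] at hunion
  calc _ ≤ _ := hunion
    _ ≤ Real.exp (n * (a + Real.negMulLog a)) * Real.exp (n * (b + Real.negMulLog b)) *
        Real.exp (-(p * ((a * n - 1) * (b * n - 1)))) := by
      gcongr
      · exact hchoose ha1 han
      · exact hchoose hb1 hbn
    _ = _ := by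
      rw [← Real.exp_add, ← Real.exp_add]
      ring_nf

theorem whp_not_hasIndepSet {a b d : ℝ} (hd : 0 ≤ d) (ha : 0 < a) (ha1 : a ≤ 1) (hb : 0 < b)
    (hb1 : b ≤ 1) (hab : a + Real.negMulLog a + (b + Real.negMulLog b) < d * (a * b)) :
    Whp d fun n G => ¬ HasIndepSet G (a * n - 1) (b * n - 1) := by
  rw [whp_not_iff]
  set c := a + Real.negMulLog a + (b + Real.negMulLog b)
  have hlim : Tendsto (fun n : ℕ => Real.exp (n * (c - d * (a * b)) + d * (a + b))) atTop (𝓝 0) :=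
    Real.tendsto_exp_atBot.comp (tendsto_atBot_add_const_right _ _
      (tendsto_natCast_atTop_atTop.atTop_mul_const_of_neg (sub_neg.2 hab)))
  refine squeeze_zero' (Eventually.of_forall fun n => measureReal_nonneg) ?_ hlim
  have hlarge {u : ℝ} (hu : 0 < u) : ∀ᶠ n : ℕ in atTop, 1 ≤ u * n :=
    (tendsto_natCast_atTop_atTop.const_mul_atTop hu).eventually_ge_atTop 1
  filter_upwards [eventually_edgeProb_eq hd, hlarge ha, hlarge hb, eventually_gt_atTop 0]
    with n hp han hbn hn
  simp only [hasIndepSet_bipGraph_iff, bipLaw_eq_bernoulliPi]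
  refine (bernoulliPi_real_hasEmptyRect_ceil_le ha1 hb1 han hbn).trans (Real.exp_le_exp.2 ?_)
  have hexpand : d / n * ((a * n - 1) * (b * n - 1)) = n * (d * (a * b)) - d * (a + b) + d / n := by
    field_simp
    ring
  have hdn : 0 ≤ d / n := by positivity
  rw [hp, hexpand]
  linarith

end Supercritical

section Subcritical

lemma tendsto_sq_mul_exp_neg_mul {c : ℝ} (hc : 0 < c) :
    Tendsto (fun n : ℕ => ((n : ℝ) + 1) ^ 2 * Real.exp (-c * n)) atTop (𝓝 0) := by
  have hpow (m : ℕ) : Tendsto (fun n : ℕ => (n : ℝ) ^ m * Real.exp (-c * n)) atTop (𝓝 0) := by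
    have := (tendsto_rpow_mul_exp_neg_mul_atTop_nhds_zero m c hc).comp
      (tendsto_natCast_atTop_atTop (R := ℝ))
    simpa [Function.comp_def] using this
  have hsum := ((hpow 2).add ((hpow 1).const_mul 2)).add (hpow 0)
  simp only [mul_zero, add_zero] at hsum
  exact hsum.congr fun n => by ring

lemma bernoulliPi_real_not_hasEmptyRect_le {n : ℕ} {p : unitInterval} (hp : p < 1)
    {k l : ℕ} (hk : k ≤ n) (hl : l ≤ n) {M Λ v : ℝ} (hM : 0 ≤ M) (hΛ : 1 ≤ Λ)
    (hpM : (1 - p : ℝ)⁻¹ ≤ Real.exp M)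
    (hkM : M * (Real.exp (Λ + 1) * ((k : ℝ) ^ 2 / n)) ≤ 1)
    (hlM : M * (Real.exp (Λ + 1) * ((l : ℝ) ^ 2 / n)) ≤ 1)
    (hkl : M * (k * l) ≤ Λ * (k + l)) (hv : v ≤ k) :
    (bernoulliPi (Fin n × Fin n) p).real {A | ¬ HasEmptyRect A ⌈v⌉₊ l} ≤
      (k + 1) * (l + 1) * Real.exp (M * ((Real.exp 2 * ((k : ℝ) ^ 2 / n)) *
        (Real.exp 2 * ((l : ℝ) ^ 2 / n))) - (k - v) ^ 2 / (2 * n)) := by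
  have hfirst := one_le_mul_exp_mul_bernoulliPi_real_hasEmptyRect (ι := Fin n) (κ := Fin n) hp
    (by simpa using hk) (by simpa using hl) hM hΛ hpM (by simpa using hkM) (by simpa using hlM) hkl
  have hconc := bernoulliPi_real_hasEmptyRect_mul_real_not_le (n := n) (κ := Fin n) p
    (by simpa using hl) hv
  rw [Fintype.card_fin] at hfirst
  set B := M * ((Real.exp 2 * ((k : ℝ) ^ 2 / n)) * (Real.exp 2 * ((l : ℝ) ^ 2 / n)))
  set q := (bernoulliPi (Fin n × Fin n) p).real {A | HasEmptyRect A k l}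
  set r := (bernoulliPi (Fin n × Fin n) p).real {A | ¬ HasEmptyRect A ⌈v⌉₊ l}
  calc r ≤ (k + 1) * (l + 1) * Real.exp B * q * r := le_mul_of_one_le_left measureReal_nonneg hfirst
    _ = (k + 1) * (l + 1) * Real.exp B * (q * r) := mul_assoc _ _ _
    _ ≤ (k + 1) * (l + 1) * Real.exp B * Real.exp (-(k - v) ^ 2 / (2 * n)) := by gcongr
    _ = (k + 1) * (l + 1) * Real.exp (B - (k - v) ^ 2 / (2 * n)) := by
      rw [mul_assoc, ← Real.exp_add, neg_div, ← sub_eq_add_neg]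

lemma sq_div_le_sq_mul {n k : ℕ} {a : ℝ} (hk : k ≤ a * n) :
    (k : ℝ) ^ 2 / n ≤ a ^ 2 * n := by
  rcases n.eq_zero_or_pos with rfl | hn
  · simp
  · rw [div_le_iff₀ (Nat.cast_pos.2 hn)]
    exact (pow_le_pow_left₀ k.cast_nonneg hk 2).trans_eq (by ring)

lemma div_mul_mul_le_mul_add {n k l : ℕ} {a b D Λ : ℝ} (hD : 0 ≤ D) (hΛ : 0 ≤ Λ)
    (hk : k ≤ a * n) (hl : l ≤ b * n) (hab : D * (a * b) ≤ Λ * (a + b)) :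
    D / n * (k * l) ≤ Λ * (k + l) := by
  rcases k.eq_zero_or_pos with rfl | hk0
  · rw [Nat.cast_zero, zero_mul, mul_zero]
    positivity
  · refine mul_mul_le_of_le (Nat.cast_pos.2 hk0) l.cast_nonneg hk hl (by positivity) ?_
    have hn : n ≠ 0 := by
      rintro rfl
      simp [hk0.ne'] at hk
    calc D / n * (a * n * (b * n)) = D * (a * b) * n := by field_simp
      _ ≤ Λ * (a + b) * n := mul_le_mul_of_nonneg_right hab n.cast_nonneg
      _ = Λ * (a * n + b * n) := by ring

lemma bernoulliPi_real_not_hasEmptyRect_floor_le {n : ℕ} (hn : 0 < n) {p : unitInterval}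
    (hp : p < 1) {a b D Λ τ : ℝ} (ha : 0 < a) (ha1 : a ≤ 1) (hb : 0 < b) (hb1 : b ≤ 1)
    (hD : 0 ≤ D) (hΛ : 1 ≤ Λ) (hτ : 0 ≤ τ) (hpD : (1 - p : ℝ)⁻¹ ≤ Real.exp (D / n))
    (haD : D * (Real.exp (Λ + 1) * a ^ 2) ≤ 1) (hbD : D * (Real.exp (Λ + 1) * b ^ 2) ≤ 1)
    (hab : D * (a * b) ≤ Λ * (a + b)) :
    (bernoulliPi (Fin n × Fin n) p).real {A | ¬ HasEmptyRect A ⌈(a - τ) * n - 1⌉₊ ⌊b * n⌋₊} ≤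
      ((n : ℝ) + 1) ^ 2 * Real.exp
        (-(τ ^ 2 / 2 - D * ((Real.exp 2 * a ^ 2) * (Real.exp 2 * b ^ 2))) * n) := by
  have hn0 : (0 : ℝ) < n := Nat.cast_pos.2 hn
  have hcard {c : ℝ} (hc : 0 ≤ c) (hc1 : c ≤ 1) : (⌊c * n⌋₊ : ℝ) ≤ c * n ∧ ⌊c * (n : ℝ)⌋₊ ≤ n :=
    ⟨Nat.floor_le (by positivity), Nat.floor_le_of_le (mul_le_of_le_one_left hn0.le hc1)⟩
  have hsq {c : ℝ} {m : ℕ} (hm : m ≤ c * n) (hcD : D * (Real.exp (Λ + 1) * c ^ 2) ≤ 1) :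
      D / n * (Real.exp (Λ + 1) * ((m : ℝ) ^ 2 / n)) ≤ 1 := by
    calc _ ≤ D / n * (Real.exp (Λ + 1) * (c ^ 2 * n)) := by gcongr; exact sq_div_le_sq_mul hm
      _ = D * (Real.exp (Λ + 1) * c ^ 2) := by field_simp
      _ ≤ 1 := hcD
  obtain ⟨hka, hkn⟩ := hcard ha.le ha1
  obtain ⟨hlb, hln⟩ := hcard hb.le hb1
  have hkτ : τ * n ≤ ⌊a * n⌋₊ - ((a - τ) * n - 1) := by
    linarith [Nat.lt_floor_add_one (a * (n : ℝ))]
  set k := ⌊a * (n : ℝ)⌋₊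
  set l := ⌊b * (n : ℝ)⌋₊
  refine (bernoulliPi_real_not_hasEmptyRect_le hp hkn hln (by positivity) hΛ hpD (hsq hka haD)
    (hsq hlb hbD) (div_mul_mul_le_mul_add hD (by positivity) hka hlb hab)
    (by linarith [mul_nonneg hτ hn0.le])).trans ?_
  calc _ ≤ ((n : ℝ) + 1) * (n + 1) * Real.exp (D / n * ((Real.exp 2 * (a ^ 2 * n)) *
        (Real.exp 2 * (b ^ 2 * n))) - (τ * n) ^ 2 / (2 * n)) := by
        gcongr
        · exact sq_div_le_sq_mul hka
        · exact sq_div_le_sq_mul hlb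
    _ = _ := by
        rw [← sq]
        congr 2
        field_simp
        ring

theorem whp_hasIndepSet {a b d D Λ τ : ℝ} (hd : 0 ≤ d) (hdD : d < D) (ha : 0 < a) (ha1 : a ≤ 1)
    (hb : 0 < b) (hb1 : b ≤ 1) (hΛ : 1 ≤ Λ) (hτ : 0 ≤ τ)
    (haD : D * (Real.exp (Λ + 1) * a ^ 2) ≤ 1) (hbD : D * (Real.exp (Λ + 1) * b ^ 2) ≤ 1)
    (hab : D * (a * b) ≤ Λ * (a + b))
    (hτD : D * ((Real.exp 2 * a ^ 2) * (Real.exp 2 * b ^ 2)) < τ ^ 2 / 2) :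
    Whp d fun n G => HasIndepSet G ((a - τ) * n - 1) (b * n - 1) := by
  suffices h : Whp d fun n G => ¬ ¬ HasIndepSet G ((a - τ) * n - 1) (b * n - 1) from
    h.mono (Eventually.of_forall fun n G => not_not.1)
  rw [whp_not_iff]
  refine squeeze_zero' (Eventually.of_forall fun n => measureReal_nonneg) ?_
    (tendsto_sq_mul_exp_neg_mul (sub_pos.2 hτD))
  filter_upwards [eventually_inv_one_sub_edgeProb_le hd hdD, eventually_gt_atTop 0] with n hp hn
  have hl : ⌈b * n - 1⌉₊ ≤ ⌊b * n⌋₊ := by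
    rw [Nat.ceil_le]
    linarith [Nat.lt_floor_add_one (b * (n : ℝ))]
  simp only [hasIndepSet_bipGraph_iff, bipLaw_eq_bernoulliPi]
  refine (measureReal_mono fun A hA => ?_).trans (bernoulliPi_real_not_hasEmptyRect_floor_le hn hp.1
    ha ha1 hb hb1 (hd.trans hdD.le) hΛ hτ hp.2 haD hbD hab)
  exact fun h => hA (h.mono le_rfl hl)

end Subcritical

section Threshold

variable {γ K : ℝ}

lemma tendsto_log_div_self : Tendsto (fun d : ℝ => Real.log d / d) atTop (𝓝 0) := by
  simpa using Real.isLittleO_log_id_atTop.tendsto_div_nhds_zero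

lemma eventually_log_div_self_pos : ∀ᶠ d : ℝ in atTop, 0 < Real.log d / d := by
  filter_upwards [eventually_gt_atTop 1] with d hd
  exact div_pos (Real.log_pos hd) (zero_lt_one.trans hd)

lemma eventually_mul_exp_mul_sq_log_div_le_one {η : ℝ} (hη : 0 < η) (C : ℝ) :
    ∀ᶠ d : ℝ in atTop, C * d * Real.exp ((1 - η) * Real.log d) * (Real.log d / d) ^ 2 ≤ 1 := by
  have hlim : Tendsto (fun d : ℝ => C * (Real.log d ^ 2 * Real.exp (-η * Real.log d)))
      atTop (𝓝 0) := by
    have := (tendsto_rpow_mul_exp_neg_mul_atTop_nhds_zero 2 η hη).comp Real.tendsto_log_atTop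
    simpa [Function.comp_def] using this.const_mul C
  filter_upwards [hlim.eventually_le_const zero_lt_one, eventually_gt_atTop 0] with d hd hd0
  have hexp : Real.exp ((1 - η) * Real.log d) = d * Real.exp (-η * Real.log d) := by
    rw [sub_mul, one_mul, sub_eq_add_neg, ← neg_mul, Real.exp_add, Real.exp_log hd0]
  refine le_of_eq_of_le ?_ hd
  rw [hexp]
  field_simp

lemma eventually_mul_log_div_pow_four_lt {c : ℝ} (hc : 0 < c) (C : ℝ) :
    ∀ᶠ d : ℝ in atTop, C * d * (Real.log d / d) ^ 4 < c * (Real.log d / d) ^ 2 := by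
  have hlim : Tendsto (fun d : ℝ => C * (Real.log d ^ 2 / d)) atTop (𝓝 0) := by
    have := (Real.isLittleO_pow_log_id_atTop (n := 2)).tendsto_div_nhds_zero
    simpa using this.const_mul C
  filter_upwards [hlim.eventually_lt_const hc, eventually_gt_atTop 0, eventually_log_div_self_pos]
    with d hd hd0 hpos
  refine lt_of_eq_of_lt ?_ (mul_lt_mul_of_pos_right hd (pow_pos hpos 2))
  field_simp

lemma add_negMulLog_le_mul_log {a d : ℝ} (ha : 0 < a) (hd : 0 < d) (h : Real.exp 1 ≤ a * d) :
    a + Real.negMulLog a ≤ a * Real.log d := by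
  have hlog : 1 ≤ Real.log a + Real.log d := by
    rw [← Real.log_mul ha.ne' hd.ne']
    exact (Real.le_log_iff_exp_le (mul_pos ha hd)).2 h
  rw [Real.negMulLog]
  linarith [mul_le_mul_of_nonneg_left hlog ha.le]

theorem eventually_whp_not_hasIndepSet (hγ : 0 < γ) (hγ1 : γ < 1) (hK : 1 < γ * (1 - γ) * K) :
    ∀ᶠ d : ℝ in atTop, Whp d fun n G => ¬ HasIndepSet G
      (γ * (K * (Real.log d / d)) * n - 1) ((1 - γ) * (K * (Real.log d / d)) * n - 1) := by
  have hγ' : 0 < 1 - γ := sub_pos.2 hγ1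
  have hK0 : 0 < K := pos_of_mul_pos_right (zero_lt_one.trans hK) (by positivity)
  have hsmall : Tendsto (fun d : ℝ => K * (Real.log d / d)) atTop (𝓝 0) := by
    simpa using tendsto_log_div_self.const_mul K
  have hlarge {c : ℝ} (hc : 0 < c) : ∀ᶠ d : ℝ in atTop, Real.exp 1 ≤ c * K * Real.log d :=
    (Real.tendsto_log_atTop.const_mul_atTop (mul_pos hc hK0)).eventually_ge_atTop _
  filter_upwards [hsmall.eventually_le_const zero_lt_one, hlarge hγ, hlarge hγ',
    eventually_gt_atTop 1] with d hσ1 hγd hγd' hd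
  have hd0 : 0 < d := zero_lt_one.trans hd
  have hL : 0 < Real.log d := Real.log_pos hd
  set σ := K * (Real.log d / d) with hσ
  have hσ0 : 0 < σ := by positivity
  have hσd : σ * d = K * Real.log d := by rw [hσ]; field_simp
  have hentropy {c : ℝ} (hc : 0 < c) (hcd : Real.exp 1 ≤ c * K * Real.log d) :
      c * σ + Real.negMulLog (c * σ) ≤ c * σ * Real.log d := by
    refine add_negMulLog_le_mul_log (mul_pos hc hσ0) hd0 ?_
    rwa [mul_assoc, hσd, ← mul_assoc]
  refine whp_not_hasIndepSet hd0.le (by positivity) (mul_le_one₀ hγ1.le hσ0.le hσ1)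
    (by positivity) (mul_le_one₀ (by linarith) hσ0.le hσ1) ?_
  calc γ * σ + Real.negMulLog (γ * σ) + ((1 - γ) * σ + Real.negMulLog ((1 - γ) * σ))
      ≤ γ * σ * Real.log d + (1 - γ) * σ * Real.log d := add_le_add (hentropy hγ hγd)
        (hentropy hγ' hγd')
    _ = 1 * (σ * Real.log d) := by ring
    _ < γ * (1 - γ) * K * (σ * Real.log d) := mul_lt_mul_of_pos_right hK (by positivity)
    _ = γ * (1 - γ) * σ * (σ * d) := by rw [hσd]; ring
    _ = d * (γ * σ * ((1 - γ) * σ)) := by ring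

lemma whp_hasIndepSet_of_mul_le {σ τ d D Λ : ℝ} (hγ : 0 < γ) (hγ1 : γ < 1) (hσ : 0 < σ)
    (hσ1 : σ ≤ 1) (hd : 0 ≤ d) (hdD : d < D) (hΛ : 1 ≤ Λ) (hτ : 0 ≤ τ)
    (hσD : D * (Real.exp (Λ + 1) * σ ^ 2) ≤ 1) (hcrit : D * (γ * (1 - γ) * σ) ≤ Λ)
    (hτD : D * (Real.exp 2 * σ ^ 2) ^ 2 < τ ^ 2 / 2) :
    Whp d fun n G => HasIndepSet G ((γ * σ - τ) * n - 1) ((1 - γ) * σ * n - 1) := by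
  have hD : 0 ≤ D := hd.trans hdD.le
  have hγ' : 0 < 1 - γ := sub_pos.2 hγ1
  have hsq {c : ℝ} (hc : 0 < c) (hc1 : c < 1) : (c * σ) ^ 2 ≤ σ ^ 2 :=
    pow_le_pow_left₀ (by positivity) (mul_le_of_le_one_left hσ.le hc1.le) 2
  have hexp {c : ℝ} (hc : 0 < c) (hc1 : c < 1) : D * (Real.exp (Λ + 1) * (c * σ) ^ 2) ≤ 1 :=
    le_trans (by gcongr D * (_ * ?_); exact hsq hc hc1) hσD
  refine whp_hasIndepSet hd hdD (by positivity) (mul_le_one₀ hγ1.le hσ.le hσ1) (by positivity)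
    (mul_le_one₀ (by linarith) hσ.le hσ1) hΛ hτ (hexp hγ hγ1) (hexp hγ' (by linarith)) ?_ ?_
  · calc D * (γ * σ * ((1 - γ) * σ)) = D * (γ * (1 - γ) * σ) * σ := by ring
      _ ≤ Λ * σ := mul_le_mul_of_nonneg_right hcrit hσ.le
      _ = Λ * (γ * σ + (1 - γ) * σ) := by ring
  · calc D * (Real.exp 2 * (γ * σ) ^ 2 * (Real.exp 2 * ((1 - γ) * σ) ^ 2))
        ≤ D * (Real.exp 2 * σ ^ 2 * (Real.exp 2 * σ ^ 2)) := by
          gcongr D * (_ * ?_ * (_ * ?_))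
          · exact hsq hγ hγ1
          · exact hsq hγ' (by linarith)
      _ < τ ^ 2 / 2 := by rwa [← sq]

theorem eventually_whp_hasIndepSet (hγ : 0 < γ) (hγ1 : γ < 1) (hK0 : 0 < K)
    (hK : γ * (1 - γ) * K < 1) :
    ∀ᶠ d : ℝ in atTop, Whp d fun n G => HasIndepSet G
      (γ * (K * (Real.log d / d)) * n - 1) ((1 - γ) * (K * (Real.log d / d)) * n - 1) := by
  have hγ' : 0 < γ * (1 - γ) := mul_pos hγ (sub_pos.2 hγ1)
  obtain ⟨K₁, hKK₁, hK₁⟩ : ∃ K₁, K < K₁ ∧ K₁ < 1 / (γ * (1 - γ)) :=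
    exists_between ((lt_div_iff₀' hγ').2 hK)
  rw [lt_div_iff₀' hγ'] at hK₁
  have hK₁0 : 0 < K₁ := hK0.trans hKK₁
  obtain ⟨η, hη⟩ : ∃ η, γ * (1 - γ) * K₁ = 1 - 2 * η := ⟨(1 - γ * (1 - γ) * K₁) / 2, by ring⟩
  have hη0 : 0 < η := by linarith
  have hη1 : η < 1 := by linarith [mul_pos hγ' hK₁0]
  have hκ : 0 < γ * (K₁ - K) := mul_pos hγ (sub_pos.2 hKK₁)
  have hsmall : Tendsto (fun d : ℝ => K₁ * (Real.log d / d)) atTop (𝓝 0) := by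
    simpa using tendsto_log_div_self.const_mul K₁
  filter_upwards [hsmall.eventually_le_const zero_lt_one,
    eventually_mul_exp_mul_sq_log_div_le_one hη0 ((1 + η) * Real.exp 1 * K₁ ^ 2),
    eventually_mul_log_div_pow_four_lt (half_pos (pow_pos hκ 2))
      ((1 + η) * Real.exp 2 ^ 2 * K₁ ^ 4),
    (Real.tendsto_log_atTop.const_mul_atTop (sub_pos.2 hη1)).eventually_ge_atTop 1,
    eventually_gt_atTop 0, eventually_log_div_self_pos] with d hσ1 hone hfour hΛ hd hρ
  have hdρ : d * (Real.log d / d) = Real.log d := mul_div_cancel₀ _ hd.ne'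
  have hL : 0 < Real.log d := hdρ ▸ mul_pos hd hρ
  set ρ := Real.log d / d
  refine (whp_hasIndepSet_of_mul_le (D := (1 + η) * d) (τ := γ * (K₁ - K) * ρ) hγ hγ1
    (mul_pos hK₁0 hρ) hσ1 hd.le (lt_mul_of_one_lt_left hd (by linarith)) hΛ (mul_pos hκ hρ).le
    ?_ ?_ ?_).mono ?_
  · exact le_of_eq_of_le (by rw [Real.exp_add]; ring) hone
  · calc (1 + η) * d * (γ * (1 - γ) * (K₁ * ρ))
        = (1 + η) * (γ * (1 - γ) * K₁) * (d * ρ) := by ring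
      _ = (1 - η - 2 * η ^ 2) * Real.log d := by rw [hη, hdρ]; ring
      _ ≤ (1 - η) * Real.log d := mul_le_mul_of_nonneg_right (by linarith [sq_nonneg η]) hL.le
  · exact (lt_of_eq_of_lt (by ring) hfour).trans_eq (by ring)
  · exact Eventually.of_forall fun n G h => h.mono (le_of_eq (by ring)) (by gcongr)

end Threshold

section Density

variable {γ c ε d : ℝ} {X : ∀ n : ℕ, SimpleGraph (Vertex n) → ℕ}

/-- With high probability `X / (2n)` is within `ε * (log d / d)` of `c * (log d / d)`. -/
def WhpDensityNear (c ε d : ℝ) (X : ∀ n : ℕ, SimpleGraph (Vertex n) → ℕ) : Prop :=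
  Whp d fun n G => (c - ε) * (Real.log d / d) ≤ (X n G : ℝ) / (2 * (n : ℝ)) ∧
    (X n G : ℝ) / (2 * (n : ℝ)) ≤ (c + ε) * (Real.log d / d)

lemma WhpDensityNear.mono {ε' : ℝ} (h : WhpDensityNear c ε d X) (hε : ε ≤ ε')
    (hd : 0 ≤ Real.log d / d) : WhpDensityNear c ε' d X := by
  refine Whp.mono h (Eventually.of_forall fun n G hG => ⟨le_trans ?_ hG.1, hG.2.trans ?_⟩) <;>
    gcongr

lemma eventually_whp_maxGammaBalanced_le {K : ℝ} (hγ : 0 < γ) (hγ1 : γ < 1)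
    (hK : 1 < γ * (1 - γ) * K) :
    ∀ᶠ d : ℝ in atTop, Whp d fun n G =>
      (maxGammaBalanced γ G : ℝ) ≤ K * (Real.log d / d) * n := by
  filter_upwards [eventually_whp_not_hasIndepSet hγ hγ1 hK] with d hd
  refine hd.mono (Eventually.of_forall fun n G hG => ?_)
  contrapose! hG
  simpa only [mul_assoc] using HasIndepSet.of_le_maxGammaBalanced hγ.le hγ1.le hG.le

lemma eventually_whp_mul_le {K : ℝ} (hγ : 0 < γ) (hγ1 : γ < 1) (hK : γ * (1 - γ) * K < 1)
    (hX : ∀ n (G : SimpleGraph (Vertex n)) (s : ℝ), 0 < s →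
      HasIndepSet G (γ * s - 1) ((1 - γ) * s - 1) → s - 2 ≤ X n G) :
    ∀ᶠ d : ℝ in atTop, Whp d fun n G => K * (Real.log d / d) * n ≤ X n G := by
  have hγ' : 0 < γ * (1 - γ) := mul_pos hγ (sub_pos.2 hγ1)
  obtain ⟨K₁, hKK₁, hK₁⟩ : ∃ K₁, max K 0 < K₁ ∧ K₁ < 1 / (γ * (1 - γ)) :=
    exists_between (max_lt ((lt_div_iff₀' hγ').2 hK) (one_div_pos.2 hγ'))
  obtain ⟨hKK₁, hK₁0⟩ := max_lt_iff.1 hKK₁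
  filter_upwards [eventually_whp_hasIndepSet hγ hγ1 hK₁0 ((lt_div_iff₀' hγ').1 hK₁),
    eventually_log_div_self_pos] with d hd hρ
  have hgap : Tendsto (fun n : ℕ => (K₁ - K) * (Real.log d / d) * n) atTop atTop :=
    tendsto_natCast_atTop_atTop.const_mul_atTop (mul_pos (sub_pos.2 hKK₁) hρ)
  refine hd.mono ?_
  filter_upwards [hgap.eventually_ge_atTop 2, eventually_gt_atTop 0] with n hn hn0 G hG
  simp only [mul_assoc γ, mul_assoc (1 - γ)] at hG
  linarith [hX n G _ (mul_pos (mul_pos hK₁0 hρ) (Nat.cast_pos.2 hn0)) hG]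

theorem eventually_whpDensityNear (hγ : 0 < γ) (hγ1 : γ < 1) (hε : 0 < ε)
    (hX : ∀ n (G : SimpleGraph (Vertex n)) (s : ℝ), 0 < s →
      HasIndepSet G (γ * s - 1) ((1 - γ) * s - 1) → s - 2 ≤ X n G)
    (hXle : ∀ n (G : SimpleGraph (Vertex n)), X n G ≤ maxGammaBalanced γ G) :
    ∀ᶠ d : ℝ in atTop, WhpDensityNear (1 / (2 * γ * (1 - γ))) ε d X := by
  have hγ' : 0 < 1 - γ := sub_pos.2 hγ1
  have hgap : 0 < γ * (1 - γ) * (2 * ε) := by positivity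
  have hcrit : γ * (1 - γ) * (2 * (1 / (2 * γ * (1 - γ)))) = 1 := by field_simp
  filter_upwards [eventually_whp_mul_le (K := 2 * (1 / (2 * γ * (1 - γ)) - ε)) hγ hγ1
      (by rw [mul_sub 2, mul_sub _ (2 * _), hcrit]; linarith) hX,
    eventually_whp_maxGammaBalanced_le (K := 2 * (1 / (2 * γ * (1 - γ)) + ε)) hγ hγ1
      (by rw [mul_add 2, mul_add _ (2 * _), hcrit]; linarith)] with d hlow hup
  refine (hlow.and hup).mono ?_
  filter_upwards [eventually_gt_atTop 0] with n hn G hG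
  have hn0 : (0 : ℝ) < 2 * n := by positivity
  have hle : (X n G : ℝ) ≤ maxGammaBalanced γ G := by exact_mod_cast hXle n G
  rw [le_div_iff₀ hn0, div_le_iff₀ hn0]
  constructor <;> linarith [hG.1, hG.2]

theorem eventually_whpDensityNear_maxGammaBalanced (hγ : 0 < γ) (hγ1 : γ < 1) (hε : 0 < ε) :
    ∀ᶠ d : ℝ in atTop,
      WhpDensityNear (1 / (2 * γ * (1 - γ))) ε d fun _ G => maxGammaBalanced γ G :=
  eventually_whpDensityNear hγ hγ1 hε
    (fun _ _ _ hs h => h.sub_two_le_maxGammaBalanced hγ hγ1 hs) fun _ _ => le_rfl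

lemma one_div_two_mul_half_mul_one_sub_half : 1 / (2 * (1 / 2) * (1 - 1 / 2)) = (2 : ℝ) := by
  norm_num

theorem eventually_whpDensityNear_maxGammaBalanced_half (hε : 0 < ε) :
    ∀ᶠ d : ℝ in atTop, WhpDensityNear 2 ε d fun _ G => maxGammaBalanced (1 / 2) G := by
  have h := eventually_whpDensityNear_maxGammaBalanced one_half_pos one_half_lt_one hε
  rwa [one_div_two_mul_half_mul_one_sub_half] at h

theorem eventually_whpDensityNear_maxBalanced (hε : 0 < ε) :
    ∀ᶠ d : ℝ in atTop, WhpDensityNear 2 ε d fun _ G => maxBalanced G := by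
  rw [← one_div_two_mul_half_mul_one_sub_half]
  refine eventually_whpDensityNear one_half_pos one_half_lt_one hε (fun n G s _ h => ?_)
    fun _ G => maxBalanced_le_maxGammaBalanced G
  rw [sub_half] at h
  linarith [h.two_mul_le_maxBalanced]

/-- Diagonal choice of the error: the infimum of the errors valid at `x` tends to `0`, and adding
`r x > 0` gives a valid one. -/
lemma exists_tendsto_zero_of_eventually {α : Type*} {l : Filter α} {r : α → ℝ} {P : ℝ → α → Prop}
    (hr : Tendsto r l (𝓝[>] 0)) (h : ∀ ε > 0, ∀ᶠ x in l, P ε x)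
    (hmono : ∀ᶠ x in l, ∀ ε ε', ε ≤ ε' → P ε x → P ε' x) :
    ∃ δ : α → ℝ, Tendsto δ l (𝓝 0) ∧ ∀ᶠ x in l, P (δ x) x := by
  set valid : α → Set ℝ := fun x => {ε | 0 < ε ∧ P ε x}
  have hbdd (x : α) : BddBelow (valid x) := ⟨0, fun ε hε => hε.1.le⟩
  have hnonneg (x : α) : 0 ≤ sInf (valid x) := Real.sInf_nonneg fun ε hε => hε.1.le
  have hinf : Tendsto (fun x => sInf (valid x)) l (𝓝 0) := by
    refine tendsto_order.2 ⟨fun a ha => Eventually.of_forall fun x => ha.trans_le (hnonneg x),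
      fun ε hε => ?_⟩
    filter_upwards [h (ε / 2) (half_pos hε)] with x hx
    have hmem : ε / 2 ∈ valid x := ⟨half_pos hε, hx⟩
    exact (csInf_le (hbdd x) hmem).trans_lt (half_lt_self hε)
  refine ⟨fun x => sInf (valid x) + r x, ?_, ?_⟩
  · simpa using hinf.add (tendsto_nhds_of_tendsto_nhdsWithin hr)
  · filter_upwards [h 1 one_pos, hmono, (tendsto_nhdsWithin_iff.1 hr).2] with x hone hx hrx
    obtain ⟨ε, hε, hlt⟩ := exists_lt_of_csInf_lt (s := valid x) ⟨1, one_pos, hone⟩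
      (lt_add_of_pos_right _ hrx)
    exact hx ε _ hlt.le hε.2

end Density

end BalancedIndep

open BalancedIndep in
theorem theorem1p3_general :
    (∀ γ : ℝ, 0 < γ → γ < 1 → ∀ ε : ℝ, 0 < ε → ∃ d₀ : ℝ, ∀ d : ℝ, d₀ ≤ d →
      Whp d fun n G =>
        (1 / (2 * γ * (1 - γ)) - ε) * (Real.log d / d)
            ≤ (maxGammaBalanced γ G : ℝ) / (2 * (n : ℝ)) ∧
          (maxGammaBalanced γ G : ℝ) / (2 * (n : ℝ))
            ≤ (1 / (2 * γ * (1 - γ)) + ε) * (Real.log d / d)) ∧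
    (∃ δ : ℝ → ℝ, Tendsto δ atTop (𝓝 0) ∧ ∃ d₀ : ℝ, ∀ d : ℝ, d₀ ≤ d →
      Whp d fun n G =>
        ((2 - δ d) * (Real.log d / d)
            ≤ (maxGammaBalanced (1 / 2) G : ℝ) / (2 * (n : ℝ)) ∧
          (maxGammaBalanced (1 / 2) G : ℝ) / (2 * (n : ℝ))
            ≤ (2 + δ d) * (Real.log d / d)) ∧
        ((2 - δ d) * (Real.log d / d)
            ≤ (maxBalanced G : ℝ) / (2 * (n : ℝ)) ∧
          (maxBalanced G : ℝ) / (2 * (n : ℝ))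
            ≤ (2 + δ d) * (Real.log d / d))) := by
  refine ⟨fun γ hγ hγ1 ε hε =>
    eventually_atTop.1 (eventually_whpDensityNear_maxGammaBalanced hγ hγ1 hε), ?_⟩
  set nearTwo : ℝ → ℝ → Prop := fun ε d =>
    WhpDensityNear 2 ε d (fun _ G => maxGammaBalanced (1 / 2) G) ∧
      WhpDensityNear 2 ε d fun _ G => maxBalanced G
  have hnear : ∀ ε > 0, ∀ᶠ d in atTop, nearTwo ε d := fun ε hε =>
    (eventually_whpDensityNear_maxGammaBalanced_half hε).and
      (eventually_whpDensityNear_maxBalanced hε)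
  have hmono : ∀ᶠ d in atTop, ∀ ε ε', ε ≤ ε' → nearTwo ε d → nearTwo ε' d := by
    filter_upwards [eventually_log_div_self_pos] with d hd ε ε' hε h
    exact ⟨h.1.mono hε hd.le, h.2.mono hε hd.le⟩
  obtain ⟨δ, hδ, hδnear⟩ :=
    exists_tendsto_zero_of_eventually tendsto_inv_atTop_nhdsGT_zero hnear hmono
  exact ⟨δ, hδ, eventually_atTop.1 (hδnear.mono fun d hd => Whp.and hd.1 hd.2)⟩

theorem theorem1p3 :
    (∀ γ : ℝ, 0 < γ → γ ≤ 1 / 2 → ∀ ε : ℝ, 0 < ε → ∃ d₀ : ℝ, ∀ d : ℝ, d₀ ≤ d →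
      BalancedIndep.Whp d fun n G =>
        (1 / (2 * γ * (1 - γ)) - ε) * (Real.log d / d)
            ≤ (BalancedIndep.maxGammaBalanced γ G : ℝ) / (2 * (n : ℝ)) ∧
          (BalancedIndep.maxGammaBalanced γ G : ℝ) / (2 * (n : ℝ))
            ≤ (1 / (2 * γ * (1 - γ)) + ε) * (Real.log d / d)) ∧
    (∃ δ : ℝ → ℝ, Tendsto δ atTop (𝓝 0) ∧ ∃ d₀ : ℝ, ∀ d : ℝ, d₀ ≤ d →
      BalancedIndep.Whp d fun n G =>
        ((2 - δ d) * (Real.log d / d)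
            ≤ (BalancedIndep.maxGammaBalanced (1 / 2) G : ℝ) / (2 * (n : ℝ)) ∧
          (BalancedIndep.maxGammaBalanced (1 / 2) G : ℝ) / (2 * (n : ℝ))
            ≤ (2 + δ d) * (Real.log d / d)) ∧
        ((2 - δ d) * (Real.log d / d)
            ≤ (BalancedIndep.maxBalanced G : ℝ) / (2 * (n : ℝ)) ∧
          (BalancedIndep.maxBalanced G : ℝ) / (2 * (n : ℝ))
            ≤ (2 + δ d) * (Real.log d / d))) :=
  ⟨fun γ hγ hγ2 => theorem1p3_general.1 γ hγ (by linarith),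
    theorem1p3_general.2⟩
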